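/- Let $\mu,\sigma,\rho,\Delta>0$ and $K\ge 0$, let $A=\tfrac12\sigma^2\frac{d^2}{dx^2}+\mu\frac{d}{dx}$, and let $W$ be a standard Brownian motion. Put $$r_1=\frac{-\mu+\sqrt{\mu^2+2\sigma^2\rho}}{\sigma^2},\qquad r_2=\frac{\mu+\sqrt{\mu^2+2\sigma^2\rho}}{\sigma^2},\qquad u_0=\frac1{r_1+r_2}\ln\Big[\frac{\rho+\mu r_2}{\rho-\mu r_1}\Big],$$ and let $V_0$ be the solution of $(A-\rho)V_0=0$ on $\mathbf R$ with $V_0(u_0)=\mu/\rho$, $V_0'(u_0)=1$. For $x\ge0$, $t>0$ let $p(x,t)=P(\tau_x<t)$, where $\tau_x$ is the first time at which $x+\mu s+\sigma W(s)$, $s\ge 0$, hits $0$. Let $h$ be the classical solution of $\partial h/\partial t=Ah$ for $x>0$, $t>0$, with $h(0,t)=0$ for $t>0$ and $h(x,0)=x$ for $x>0$, that is continuous on $\{x\ge0,\,t\ge0\}$ and of at most linear growth in $x$, locally uniformly in $t$. For $t>0$ let $$\beta(t)=\Big[\frac{\partial h}{\partial x}(0,t)-e^{\rho t}V_0'(0)\Big]\Big/\frac{\partial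 p}{\partial x}(0,t)$$ (derivatives from the right at $x=0$). Let $u_2(\beta,t)=u_0$ if $\beta\le\beta(t)$, and if $\beta>\beta(t)$ let $u_2(\beta,t)$ be the supremum of all $z\in\mathbf R$ such that $$\beta\{1-p(x,t)\}+h(x,t)\le e^{\rho t}V_0(x-z+u_0)\quad\text{for all }x\ge 0.$$ For $\beta>\beta(t)$ let $u_1(\beta,t)$ be the infimum of the points $x>0$ at which $$\beta\{1-p(x,t)\}+h(x,t)=e^{\rho t}V_0(x-u_2(\beta,t)+u_0).$$ Suppose that $K<\mu/\rho-u_0-\beta(\Delta)$, let $\beta>\beta(\Delta)$ satisfy $\beta+u_2(\beta,\Delta)=\mu/\rho-K$, and put $u_1=u_1(\beta,\Delta)$, $u_2=u_2(\beta,\Delta)$. Define $$V(x)=\begin{cases} e^{-\rho\Delta}\{\beta[1-p(x,\Delta)]+h(x,\Delta)\}, & 0\le x\le u_1,\\ V_0(x+u_0-u_2), & u_1<x\le u_2,\\ x-u_2+\mu/\rho, & x>u_2.\end{cases}$$ Then $u_1>0$, and $V$ is a $C^1$ function on $[0,\infty)$ (in particular it is $C^1$ at $x=u_1$), but $V$ is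 not $C^2$ at $x=u_1$. -/

import Mathlib

open MeasureTheory ProbabilityTheory Set
open scoped NNReal

namespace PeuraKeppo

noncomputable section

/-- The generator `A f = (σ² / 2) f'' + μ f'` of the diffusion `dX = μ dt + σ dW`. -/
def gen (μ σ : ℝ) (f : ℝ → ℝ) (x : ℝ) : ℝ :=
  σ ^ 2 / 2 * deriv (deriv f) x + μ * deriv f x

/-- Drifted Brownian motion `X(s) = x + μ s + σ W(s)` started at `x`. -/
def diffusion {Ω : Type*} (W : ℝ≥0 → Ω → ℝ) (μ σ x : ℝ) (s : ℝ≥0) (ω : Ω) : ℝ :=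
  x + μ * (s : ℝ) + σ * W s ω

/-- `p(x, t) = P(τ_x < t)`, where `τ_x` is the first hitting time of `0` (`⊤` if `0` is never hit)
of the diffusion started at `x`. -/
def ruinProb {Ω : Type*} [MeasurableSpace Ω] (P : Measure Ω) (W : ℝ≥0 → Ω → ℝ)
    (μ σ x t : ℝ) : ℝ :=
  P.real {ω | hittingAfter (diffusion W μ σ x) {0} 0 ω < ((t.toNNReal : ℝ≥0) : WithTop ℝ≥0)}

/-- `h` is the solution of `∂h/∂t = A h` on `x > 0, t > 0` with `h(0, t) = 0` and `h(x, 0) = x`: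
a classical solution, continuous up to the boundary and of at most linear growth in `x`, locally
uniformly in time (the class in which the solution is unique). -/
structure IsDirichletSolution (μ σ : ℝ) (h : ℝ → ℝ → ℝ) : Prop where
  continuousOn : ContinuousOn (fun q : ℝ × ℝ => h q.1 q.2) (Ici 0 ×ˢ Ici 0)
  contDiffAt : ∀ x t : ℝ, 0 < x → 0 < t → ContDiffAt ℝ 2 (fun y => h y t) x
  hasDerivAt : ∀ x t : ℝ, 0 < x → 0 < t →
    HasDerivAt (fun s => h x s) (gen μ σ (fun y => h y t) x) t
  boundary : ∀ t : ℝ, 0 < t → h 0 t = 0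
  initial : ∀ x : ℝ, 0 < x → h x 0 = x
  growth : ∀ T : ℝ, ∃ C : ℝ, ∀ x t : ℝ, 0 ≤ x → 0 ≤ t → t ≤ T → |h x t| ≤ C * (1 + x)

/-- The characteristic root `r₁`. -/
def r₁ (μ σ ρ : ℝ) : ℝ := (-μ + Real.sqrt (μ ^ 2 + 2 * σ ^ 2 * ρ)) / σ ^ 2

/-- The characteristic root `r₂`. -/
def r₂ (μ σ ρ : ℝ) : ℝ := (μ + Real.sqrt (μ ^ 2 + 2 * σ ^ 2 * ρ)) / σ ^ 2

/-- The dividend threshold `u₀` of the model without recapitalization. -/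
def u₀ (μ σ ρ : ℝ) : ℝ :=
  1 / (r₁ μ σ ρ + r₂ μ σ ρ) * Real.log ((ρ + μ * r₂ μ σ ρ) / (ρ - μ * r₁ μ σ ρ))

/-- `V₀` is the solution on the whole line of `(A - ρ) V₀ = 0`, `V₀(u₀) = μ / ρ`, `V₀'(u₀) = 1`. -/
structure IsBaseSolution (μ σ ρ : ℝ) (V₀ : ℝ → ℝ) : Prop where
  contDiff : ContDiff ℝ 2 V₀
  ode : ∀ x : ℝ, gen μ σ V₀ x - ρ * V₀ x = 0
  value : V₀ (u₀ μ σ ρ) = μ / ρ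
  slope : deriv V₀ (u₀ μ σ ρ) = 1

/-- `β(t) = [∂h/∂x(0,t) - e^{ρt} V₀'(0)] / ∂p/∂x(0,t)`; the derivatives of `h` and `p` at the
boundary point `x = 0` are taken from the right. -/
def betaCrit (ρ : ℝ) (V₀ : ℝ → ℝ) (p h : ℝ → ℝ → ℝ) (t : ℝ) : ℝ :=
  (derivWithin (fun x => h x t) (Ici 0) 0 - Real.exp (ρ * t) * deriv V₀ 0) /
    derivWithin (fun x => p x t) (Ici 0) 0

/-- `u₂(β, t)`. -/
def upper (μ σ ρ : ℝ) (V₀ : ℝ → ℝ) (p h : ℝ → ℝ → ℝ) (β t : ℝ) : ℝ :=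
  if β ≤ betaCrit ρ V₀ p h t then u₀ μ σ ρ
  else sSup {z : ℝ | ∀ x : ℝ, 0 ≤ x →
    β * (1 - p x t) + h x t ≤ Real.exp (ρ * t) * V₀ (x - z + u₀ μ σ ρ)}

/-- `u₁(β, t)`: the (first) point `x > 0` at which `β (1 - p(x,t)) + h(x,t)` touches
`e^{ρt} V₀(x - u₂(β,t) + u₀)`. -/
def lower (μ σ ρ : ℝ) (V₀ : ℝ → ℝ) (p h : ℝ → ℝ → ℝ) (β t : ℝ) : ℝ :=
  sInf {x : ℝ | 0 < x ∧ β * (1 - p x t) + h x t =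
    Real.exp (ρ * t) * V₀ (x - upper μ σ ρ V₀ p h β t + u₀ μ σ ρ)}

/-- The value function (only its values on `x ≥ 0` are meaningful):
`e^{-ρΔ} (β (1 - p(x,Δ)) + h(x,Δ))` for `0 ≤ x ≤ u₁`, `V₀(x + u₀ - u₂)` for `u₁ < x ≤ u₂`,
and `x - u₂ + μ/ρ` for `x > u₂`. -/
def value (μ σ ρ : ℝ) (V₀ : ℝ → ℝ) (p h : ℝ → ℝ → ℝ) (β Δ x : ℝ) : ℝ :=
  if x ≤ lower μ σ ρ V₀ p h β Δ then
    Real.exp (-(ρ * Δ)) * (β * (1 - p x Δ) + h x Δ)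
  else if x ≤ upper μ σ ρ V₀ p h β Δ then
    V₀ (x + u₀ μ σ ρ - upper μ σ ρ V₀ p h β Δ)
  else x - upper μ σ ρ V₀ p h β Δ + μ / ρ

end

end PeuraKeppo

/-! Put E = e^{ρΔ}, a = μ/σ², τ = σ²Δ, z = u₂, d = u₀ - z and g = β(1 - p(·,Δ)) + h(·,Δ). By
extremality of z the curve E V₀(· + d) lies above g on x ≥ 0 and touches it (`exists_touching`).
There is no contact at 0, because the slope condition β > β(Δ) forces z < u₀ and hence V₀(d) > 0 =
g(0). So u₁ > 0 is an interior minimum of the gap E V₀(· + d) - g: values and slopes of the two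
branches agree and V is C¹ at u₁. At z, V is C¹ because V₀(u₀) = μ/ρ and V₀'(u₀) = 1. What remains
is that the second derivative of the gap at u₁ is strictly positive.

For this the gap is made explicit. In the clock τ the diffusion has unit volatility and drift a. The
reflection principle (`ruinProb_eq`) and uniqueness for the Dirichlet problem
(`IsDirichletSolution.eq_absorbedMean`) show that g is the killed Gaussian semigroup applied to β +
y. Since (A - ρ)V₀ = 0, E V₀(· + d) is the free Gaussian semigroup applied to V₀(· + d). Expanding
the squares in the Gaussian densities (`gap_eq_twoSided`), the gap at x is a positive factor times
T(x/τ), where T(θ) = ∫ e^{θy} q + ∫ e^{-θy} (n - q) over y > 0, q(y) is V₀(y + d) - β - y times a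
positive weight, and n > 0 because V₀(d) > 0. As V₀' ≥ 1, q changes sign at most once, from - to +;
it is nonnegative from z on because V₀(u₀) - β - z = K ≥ 0.

A double zero of such a T is nondegenerate (`deriv_deriv_twoSided_pos`). If T = T' = 0 at θ > 0,
then θ²T'' = θ²T'' - (3+κ)θT' + (3+κ)T for every κ. With I₁(v) = v cosh v - sinh v and I₂(v) = v²
sinh v - 3 I₁(v), the right side is the integral of 2(I₂ - κI₁)(θy) q(y) plus a positive multiple of
n. Since I₂/I₁ is nondecreasing, taking for κ its value at the sign change of q makes the first term
nonnegative. -/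

namespace PeuraKeppo

noncomputable section

/-! ### Gaussian half-line masses and the image formula for survival -/

/-- The mass that a real Gaussian distribution gives to the positive half-line. -/
def posMass (m : ℝ) (v : ℝ≥0) : ℝ := (gaussianReal m v).real (Ioi 0)

lemma posMass_nonneg (m : ℝ) (v : ℝ≥0) : 0 ≤ posMass m v := measureReal_nonneg

lemma posMass_le_one (m : ℝ) (v : ℝ≥0) : posMass m v ≤ 1 := measureReal_le_one

lemma gaussianReal_preimage_add (y b : ℝ) (v : ℝ≥0) :
    (gaussianReal b v) ((fun z => y + z) ⁻¹' Ioi 0) = gaussianReal (y + b) v (Ioi 0) := by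
  rw [add_comm y b, ← gaussianReal_map_const_add y,
    Measure.map_apply (by fun_prop) measurableSet_Ioi]

lemma monotone_posMass (v : ℝ≥0) : Monotone fun m => posMass m v := by
  intro m m' h
  simp only [posMass, measureReal_def]
  have h1 := gaussianReal_preimage_add m 0 v
  have h2 := gaussianReal_preimage_add m' 0 v
  simp only [add_zero] at h1 h2
  rw [← h1, ← h2]
  refine ENNReal.toReal_mono (measure_ne_top _ _) (measure_mono ?_)
  intro z hz
  simp only [mem_preimage, mem_Ioi] at hz ⊢
  linarith

lemma measurable_posMass (v : ℝ≥0) : Measurable fun m => posMass m v :=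
  (monotone_posMass v).measurable

/-- The convolution of two Gaussian laws is Gaussian; this is the semigroup property behind
`integral_surv`. -/
lemma integral_posMass_add (m b : ℝ) (u v : ℝ≥0) :
    ∫ y, posMass (y + b) v ∂gaussianReal m u = posMass (m + b) (u + v) := by
  have h : gaussianReal (m + b) (u + v) (Ioi 0)
      = ∫⁻ y, gaussianReal (y + b) v (Ioi 0) ∂gaussianReal m u := by
    rw [← gaussianReal_conv_gaussianReal, Measure.conv,
      Measure.map_apply (by fun_prop) measurableSet_Ioi,
      Measure.prod_apply (measurableSet_Ioi.preimage (by fun_prop))]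
    refine lintegral_congr fun y => ?_
    rw [← gaussianReal_preimage_add]
    rfl
  rw [posMass, measureReal_def, h, ← integral_toReal]
  · rfl
  · have : (fun y => gaussianReal (y + b) v (Ioi 0))
        = fun y => ENNReal.ofReal (posMass (y + b) v) := by
      ext y
      rw [posMass, ofReal_measureReal]
    rw [this]
    exact ((measurable_posMass v).comp (by fun_prop : Measurable fun y : ℝ => y + b)).ennreal_ofReal.aemeasurable
  · exact ae_of_all _ fun y => measure_lt_top _ _

lemma exp_mul_gaussianPDFReal (l m y : ℝ) {v : ℝ≥0} (hv : v ≠ 0) :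
    Real.exp (l * y) * gaussianPDFReal m v y
      = Real.exp (l * m + l ^ 2 * v / 2) * gaussianPDFReal (m + l * v) v y := by
  have hv' : (v : ℝ) ≠ 0 := by exact_mod_cast hv
  simp only [gaussianPDFReal]
  rw [mul_left_comm, mul_left_comm (Real.exp (l * m + _)), ← Real.exp_add, ← Real.exp_add]
  congr 2
  field_simp
  ring

/-- Exponential tilting of a Gaussian distribution. -/
lemma integral_exp_mul_gaussianReal (l m : ℝ) (v : ℝ≥0) (f : ℝ → ℝ) :
    ∫ y, Real.exp (l * y) * f y ∂gaussianReal m v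
      = Real.exp (l * m + l ^ 2 * v / 2) * ∫ y, f y ∂gaussianReal (m + l * v) v := by
  rcases eq_or_ne v 0 with rfl | hv
  · simp
  rw [integral_gaussianReal_eq_integral_smul hv, integral_gaussianReal_eq_integral_smul hv,
    ← integral_const_mul]
  refine integral_congr_ae (ae_of_all _ fun y => ?_)
  have := exp_mul_gaussianPDFReal l m y hv
  simp only [smul_eq_mul]
  linear_combination f y * this

/-- The survival probability of Brownian motion with drift `a` started at `x` and killed at `0`,
after the time `τ`. The formula is extended to negative `x`. -/
def surv (a : ℝ) (τ : ℝ≥0) (x : ℝ) : ℝ :=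
  posMass (x + a * τ) τ - Real.exp (-2 * a * x) * posMass (a * τ - x) τ

lemma measurable_surv (a : ℝ) (τ : ℝ≥0) : Measurable (surv a τ) := by
  have h1 := (measurable_posMass τ).comp (by fun_prop : Measurable fun x : ℝ => x + a * τ)
  have h2 := (measurable_posMass τ).comp (by fun_prop : Measurable fun x : ℝ => a * τ - x)
  exact h1.sub (Measurable.mul (by fun_prop) h2)

lemma surv_le_one (a : ℝ) (τ : ℝ≥0) (x : ℝ) : surv a τ x ≤ 1 := by
  have h1 := posMass_le_one (x + a * τ) τ
  have h2 := mul_nonneg (Real.exp_pos (-2 * a * x)).le (posMass_nonneg (a * τ - x) τ)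
  unfold surv
  linarith

lemma neg_exp_le_surv (a : ℝ) (τ : ℝ≥0) (x : ℝ) : -Real.exp (-2 * a * x) ≤ surv a τ x := by
  have h1 := posMass_nonneg (x + a * τ) τ
  have h2 := mul_le_mul_of_nonneg_left (posMass_le_one (a * τ - x) τ)
    (Real.exp_pos (-2 * a * x)).le
  unfold surv
  linarith

/-- The image term is the reflection of the main term, weighted by the exponential that compensates
the drift. This antisymmetry gives the sign of `surv` on the negative half-line, hence the
comparison between killing on a grid and killing in continuous time. -/
lemma surv_neg (a : ℝ) (τ : ℝ≥0) (x : ℝ) :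
    surv a τ (-x) = -(Real.exp (2 * a * x) * surv a τ x) := by
  unfold surv
  have h : Real.exp (2 * a * x) * Real.exp (-2 * a * x) = 1 := by
    rw [← Real.exp_add]; simp
  rw [show -2 * a * -x = 2 * a * x by ring, show -x + a * τ = a * τ - x by ring,
    show a * τ - -x = x + a * τ by ring]
  linear_combination (-posMass (a * τ - x) τ) * h

lemma surv_nonneg {a : ℝ} (ha : 0 ≤ a) (τ : ℝ≥0) {x : ℝ} (hx : 0 ≤ x) : 0 ≤ surv a τ x := by
  unfold surv
  have h1 : posMass (a * τ - x) τ ≤ posMass (x + a * τ) τ := monotone_posMass τ (by linarith)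
  have h2 : Real.exp (-2 * a * x) ≤ 1 := Real.exp_le_one_iff.2 (by nlinarith [mul_nonneg ha hx])
  nlinarith [posMass_nonneg (a * τ - x) τ]

lemma surv_nonpos {a : ℝ} (ha : 0 ≤ a) (τ : ℝ≥0) {x : ℝ} (hx : x ≤ 0) : surv a τ x ≤ 0 := by
  have h := surv_neg a τ (-x)
  rw [neg_neg] at h
  rw [h]
  have := mul_nonneg (Real.exp_pos (2 * a * -x)).le (surv_nonneg ha τ (x := -x) (by linarith))
  linarith

lemma surv_zero_of_pos (a : ℝ) {x : ℝ} (hx : 0 < x) : surv a 0 x = 1 := by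
  simp [surv, posMass, measureReal_def, hx, hx.le]

lemma integrable_exp_mul_bounded {m l : ℝ} {v : ℝ≥0} {f : ℝ → ℝ} (hf : Measurable f)
    (hb : ∀ y, |f y| ≤ 1) : Integrable (fun y => Real.exp (l * y) * f y) (gaussianReal m v) :=
  (integrable_exp_mul_gaussianReal l).mul_bdd (c := 1) hf.aestronglyMeasurable (ae_of_all _ hb)

lemma integrable_surv (a m : ℝ) (τ δ : ℝ≥0) : Integrable (surv a τ) (gaussianReal m δ) := by
  have hb (z : ℝ) : |posMass z τ| ≤ 1 := by
    rw [abs_of_nonneg (posMass_nonneg _ _)]; exact posMass_le_one _ _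
  have h1 : Integrable (fun x => posMass (x + a * τ) τ) (gaussianReal m δ) := by
    refine (integrable_const (1 : ℝ)).mono'
      ((measurable_posMass τ).comp (by fun_prop : Measurable fun x : ℝ => x + a * τ)).aestronglyMeasurable
      (ae_of_all _ fun y => hb _)
  exact h1.sub (integrable_exp_mul_bounded
    ((measurable_posMass τ).comp (by fun_prop : Measurable fun x : ℝ => a * τ - x)) fun y => hb _)

/-- The semigroup property of the survival function, extended to the whole line. -/
lemma integral_surv (a x : ℝ) (τ δ : ℝ≥0) :
    ∫ y, surv a τ y ∂gaussianReal (x + a * δ) δ = surv a (δ + τ) x := by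
  have hb (z : ℝ) : |posMass z τ| ≤ 1 := by
    rw [abs_of_nonneg (posMass_nonneg _ _)]; exact posMass_le_one _ _
  have h1 : Integrable (fun x => posMass (x + a * τ) τ) (gaussianReal (x + a * δ) δ) := by
    refine (integrable_const (1 : ℝ)).mono'
      ((measurable_posMass τ).comp (by fun_prop : Measurable fun x : ℝ => x + a * τ)).aestronglyMeasurable
      (ae_of_all _ fun y => hb _)
  have h2 : Integrable (fun y => Real.exp (-2 * a * y) * posMass (a * τ - y) τ)
      (gaussianReal (x + a * δ) δ) := integrable_exp_mul_bounded
    ((measurable_posMass τ).comp (by fun_prop : Measurable fun x : ℝ => a * τ - x)) fun y => hb _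
  have h3 : ∫ y, posMass (a * τ - y) τ ∂gaussianReal (x + a * δ + -2 * a * δ) δ
      = posMass (a * δ - x + a * τ) (δ + τ) := by
    -- Tilting by e^{-2ay} turns the drift a into -a; reflecting y to -y then brings the image term
    -- back to the form of `integral_posMass_add`.
    rw [← integral_posMass_add, show a * (δ : ℝ) - x = -(x + a * δ + -2 * a * δ) by ring,
      ← gaussianReal_map_neg, integral_map (by fun_prop)]
    · refine integral_congr_ae (ae_of_all _ fun y => ?_)
      simp only [neg_add_eq_sub]
    · exact ((measurable_posMass τ).comp
        (by fun_prop : Measurable fun x : ℝ => x + a * τ)).aestronglyMeasurable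
  simp only [surv]
  rw [integral_sub h1 h2, integral_posMass_add, integral_exp_mul_gaussianReal, h3]
  push_cast
  rw [show -2 * a * (x + a * δ) + (-2 * a) ^ 2 * δ / 2 = -2 * a * x by ring]
  congr 2
  · ring
  · congr 1
    ring

/-- Killing at one step of a random walk leaves at least the continuous survival probability. -/
lemma surv_le_integral_indicator {a : ℝ} (ha : 0 ≤ a) (τ δ : ℝ≥0) (x : ℝ) :
    surv a (δ + τ) x ≤ ∫ y, (Ioi 0).indicator (surv a τ) y ∂gaussianReal (x + a * δ) δ := by
  rw [← integral_surv]
  refine integral_mono (integrable_surv _ _ _ _)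
    ((integrable_surv _ _ _ _).indicator measurableSet_Ioi) fun y => ?_
  by_cases hy : 0 < y
  · simp [indicator, hy]
  · simp only [indicator, mem_Ioi, hy, if_false]
    exact surv_nonpos ha τ (not_lt.1 hy)

/-- Reverse of `surv_le_integral_indicator`, with an error. Moving the boundary down by ε makes the
negative part of `surv` matter only after a jump below -ε, which an exponential Chebyshev bound
controls. The parameter l is left free so that it can grow as the grid is refined. -/
lemma integral_indicator_surv_le {a l ε : ℝ} (ha : 0 ≤ a) (hl : 2 * a ≤ l)
    (τ δ : ℝ≥0) {x : ℝ} (hx : 0 ≤ x) :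
    ∫ y, (Ioi 0).indicator (fun y => surv a τ (y + ε)) y ∂gaussianReal (x + a * δ) δ
      ≤ surv a (δ + τ) (x + ε) + Real.exp (-(l * ε) + l ^ 2 * δ / 2) := by
  have hshift : gaussianReal (x + ε + a * δ) δ = (gaussianReal (x + a * δ) δ).map (· + ε) := by
    rw [gaussianReal_map_add_const]; congr 1; ring
  have h1 : surv a (δ + τ) (x + ε) = ∫ y, surv a τ (y + ε) ∂gaussianReal (x + a * δ) δ := by
    rw [← integral_surv, hshift, integral_map (by fun_prop)
      (measurable_surv a τ).aestronglyMeasurable]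
  have hi : Integrable (fun y => surv a τ (y + ε)) (gaussianReal (x + a * δ) δ) := by
    have := integrable_surv a (x + ε + a * δ) τ δ
    rw [hshift] at this
    exact this.comp_measurable (by fun_prop)
  have he : Integrable (fun y => Real.exp (-l * ε) * Real.exp (-l * y))
      (gaussianReal (x + a * δ) δ) := (integrable_exp_mul_gaussianReal (-l)).const_mul _
  have h2 : ∫ y, Real.exp (-l * ε) * Real.exp (-l * y) ∂gaussianReal (x + a * δ) δ
      ≤ Real.exp (-(l * ε) + l ^ 2 * δ / 2) := by
    have := integral_exp_mul_gaussianReal (-l) (x + a * δ) δ (fun _ => 1)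
    simp only [mul_one, integral_const, probReal_univ, smul_eq_mul] at this
    rw [integral_const_mul, this, ← Real.exp_add]
    refine Real.exp_le_exp.2 ?_
    have : 0 ≤ l * (x + a * δ) := mul_nonneg (by linarith) (by positivity)
    nlinarith
  rw [h1]
  refine le_trans ?_ (add_le_add_right h2 _)
  rw [← integral_add hi he]
  refine integral_mono (hi.indicator measurableSet_Ioi) (hi.add he) fun y => ?_
  simp only [← Real.exp_add]
  by_cases hy : 0 < y
  · simp only [indicator, mem_Ioi, hy, if_true]
    linarith [Real.exp_pos (-l * ε + -l * y)]
  · simp only [indicator, mem_Ioi, hy, if_false]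
    by_cases hy' : 0 ≤ y + ε
    · linarith [Real.exp_pos (-l * ε + -l * y), surv_nonneg ha τ hy']
    · have h3 := neg_exp_le_surv a τ (y + ε)
      have h4 : Real.exp (-2 * a * (y + ε)) ≤ Real.exp (-l * ε + -l * y) :=
        Real.exp_le_exp.2 (by nlinarith)
      linarith

/-! ### Survival along a grid as a Markov chain -/

/-- The event that the diffusion started at `x` is positive at the times `δ, 2δ, …, nδ`. -/
def gridSurvival {Ω : Type*} (W : ℝ≥0 → Ω → ℝ) (μ σ : ℝ) (δ : ℝ≥0) (n : ℕ) (x : ℝ) : Set Ω :=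
  {ω | ∀ k < n, 0 < diffusion W μ σ x ((k + 1) * δ) ω}

/-- Markov property at the first grid time: the restarted process is independent of `W δ`, and the
first position is Gaussian. Measurability in the starting point is part of the conclusion because
the inductions below integrate this function. -/
lemma exists_gridSurvival_succ {Ω : Type*} [MeasurableSpace Ω] {P : Measure Ω}
    [IsProbabilityMeasure P] {W : ℝ≥0 → Ω → ℝ} (hW : IsPreBrownianReal W P)
    {μ σ : ℝ} {v : ℝ≥0} (hv : (v : ℝ) = σ ^ 2) (δ : ℝ≥0) (n : ℕ) (x : ℝ) :
    Measurable (fun z => P.real (gridSurvival (fun t ω => W (δ + t) ω - W δ ω) μ σ δ n z)) ∧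
    P.real (gridSurvival W μ σ δ (n + 1) x)
      = ∫ z, (Ioi 0).indicator
        (fun z => P.real (gridSurvival (fun t ω => W (δ + t) ω - W δ ω) μ σ δ n z)) z
        ∂gaussianReal (x + μ * δ) (v * δ) := by
  set W' : ℝ≥0 → Ω → ℝ := fun t ω => W (δ + t) ω - W δ ω with hW'
  have hW'm (t) : AEMeasurable (W' t) P := (hW.aemeasurable _).sub (hW.aemeasurable _)
  let Y : Ω → ℕ → ℝ := fun ω k => W' ((k + 1) * δ) ω
  have hYm : AEMeasurable Y P := aemeasurable_pi_lambda _ fun k => hW'm _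
  let S : Set (ℝ × (ℕ → ℝ)) := {q | ∀ k < n, 0 < q.1 + μ * (((k + 1) * δ : ℝ≥0) : ℝ) + σ * q.2 k}
  have hS : MeasurableSet S := by
    have : S = ⋂ k : ℕ, ⋂ _ : k < n,
        {q : ℝ × (ℕ → ℝ) | 0 < q.1 + μ * (((k + 1) * δ : ℝ≥0) : ℝ) + σ * q.2 k} := by
      ext q; simp [S]
    rw [this]
    exact MeasurableSet.iInter fun k => MeasurableSet.iInter fun _ =>
      measurableSet_lt measurable_const (by fun_prop)
  have hindep : IndepFun (W δ) Y P := by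
    have h := (hW.indepFun_shift δ).symm
    exact h.comp (φ := fun f : Iic δ → ℝ => f ⟨δ, self_mem_Iic⟩)
      (ψ := fun f : ℝ≥0 → ℝ => fun k : ℕ => f ((k + 1) * δ)) (measurable_pi_apply _) (by fun_prop)
  have hlaw : (P.map (W δ)).map (fun w => x + μ * δ + σ * w)
      = gaussianReal (x + μ * δ) (v * δ) := by
    rw [(hW.hasLaw_eval δ).map_eq]
    have : (fun w => x + μ * δ + σ * w) = (fun w => x + μ * δ + w) ∘ (fun w => σ * w) := rfl
    rw [this, ← Measure.map_map (by fun_prop) (by fun_prop), gaussianReal_map_const_mul,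
      gaussianReal_map_const_add]
    congr 1
    · ring
    · congr 1
      exact NNReal.eq hv.symm
  have hprob (z : ℝ) : P (gridSurvival W' μ σ δ n z) = P.map Y (Prod.mk z ⁻¹' S) := by
    rw [Measure.map_apply_of_aemeasurable hYm (hS.preimage measurable_prodMk_left)]
    rfl
  have : IsProbabilityMeasure (P.map Y) := Measure.isProbabilityMeasure_map hYm
  have hmeas : Measurable fun z => P (gridSurvival W' μ σ δ n z) := by
    simp_rw [hprob]
    exact measurable_measure_prodMk_left hS
  refine ⟨hmeas.ennreal_toReal, ?_⟩
  let f : ℝ × (ℕ → ℝ) → ℝ × (ℕ → ℝ) := fun q => (x + μ * δ + σ * q.1, q.2)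
  have hf : Measurable f := by fun_prop
  have hset : gridSurvival W μ σ δ (n + 1) x
      = (fun ω => (W δ ω, Y ω)) ⁻¹' (f ⁻¹' ((Prod.fst ⁻¹' Ioi 0) ∩ S)) := by
    ext ω
    simp only [gridSurvival, diffusion, mem_ofPred_eq, mem_preimage, mem_inter_iff, mem_Ioi, S, f,
      Y, hW']
    constructor
    · intro h
      refine ⟨by simpa using h 0 (by omega), fun k hk => ?_⟩
      have := h (k + 1) (by omega)
      rw [show (((k + 1 : ℕ) : ℝ≥0) + 1) * δ = δ + (k + 1) * δ by push_cast; ring] at this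
      push_cast at this ⊢
      linarith
    · rintro ⟨h0, h⟩ k hk
      rcases k with _ | k
      · simpa using h0
      · have := h k (by omega)
        rw [show (((k + 1 : ℕ) : ℝ≥0) + 1) * δ = δ + (k + 1) * δ by push_cast; ring]
        push_cast at this ⊢
        linarith
  have hT : MeasurableSet ((Prod.fst ⁻¹' Ioi (0 : ℝ)) ∩ S) :=
    (measurableSet_Ioi.preimage measurable_fst).inter hS
  have hmain : P (gridSurvival W μ σ δ (n + 1) x)
      = ∫⁻ z, (Ioi 0).indicator (fun z => P (gridSurvival W' μ σ δ n z)) z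
        ∂gaussianReal (x + μ * δ) (v * δ) := by
    rw [hset, ← Measure.map_apply_of_aemeasurable
      ((hW.aemeasurable δ).prodMk hYm) (hT.preimage hf),
      (indepFun_iff_map_prod_eq_prod_map_map (hW.aemeasurable δ) hYm).1 hindep,
      Measure.prod_apply (hT.preimage hf), ← hlaw, lintegral_map
        (hmeas.indicator measurableSet_Ioi) (by fun_prop)]
    refine lintegral_congr fun w => ?_
    by_cases hw : 0 < x + μ * δ + σ * w
    · simp only [indicator, mem_Ioi, hw, if_true, hprob]
      congr 1
      ext y
      simp [f, S, hw]
    · simp only [indicator, mem_Ioi, hw, if_false]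
      rw [← measure_empty (μ := P.map Y)]
      congr 1
      ext y
      simp [f, hw]
  rw [measureReal_def, hmain, ← integral_toReal (hmeas.indicator measurableSet_Ioi).aemeasurable]
  · refine integral_congr_ae (ae_of_all _ fun z => ?_)
    by_cases hz : 0 < z <;> simp [indicator, hz, measureReal_def]
  · refine ae_of_all _ fun z => ?_
    by_cases hz : 0 < z <;> simp [indicator, hz]

/-- Iteration of `surv_le_integral_indicator`. The process is quantified after `n` because the
induction step passes to the shifted Brownian motion. -/
lemma surv_le_measureReal_gridSurvival {Ω : Type*} [MeasurableSpace Ω] {P : Measure Ω}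
    [IsProbabilityMeasure P] {a μ σ : ℝ} (ha : 0 ≤ a) {v : ℝ≥0} (hv : (v : ℝ) = σ ^ 2) (hμ : μ = a * v) (δ : ℝ≥0) (n : ℕ) :
    ∀ {W : ℝ≥0 → Ω → ℝ}, IsPreBrownianReal W P → ∀ {x : ℝ}, 0 < x →
      surv a (n * (v * δ)) x ≤ P.real (gridSurvival W μ σ δ n x) := by
  induction n with
  | zero =>
    intro W hW x hx
    simp [gridSurvival, surv_zero_of_pos a hx]
  | succ n ih =>
    intro W hW x hx
    set s : ℝ≥0 := v * δ with hs
    obtain ⟨hm, h⟩ := exists_gridSurvival_succ hW (μ := μ) hv δ n x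
    have hdrift : x + μ * δ = x + a * s := by
      rw [hs, NNReal.coe_mul, hμ]; ring
    rw [h, ← hs, hdrift, show ((n + 1 : ℕ) : ℝ≥0) * s = s + n * s by push_cast; ring]
    refine (surv_le_integral_indicator ha _ _ _).trans (integral_mono
      ((integrable_surv _ _ _ _).indicator measurableSet_Ioi) ?_ fun z => ?_)
    · refine Integrable.indicator ((integrable_const (1 : ℝ)).mono' hm.aestronglyMeasurable
        (ae_of_all _ fun z => ?_)) measurableSet_Ioi
      rw [Real.norm_of_nonneg measureReal_nonneg]
      exact measureReal_le_one
    · by_cases hz : 0 < z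
      · simpa only [indicator, mem_Ioi, hz, if_true] using ih (hW.shift δ) hz
      · simp [indicator, hz]

/-- Each of the n steps costs one error term of `integral_indicator_surv_le`, while the shift ε is
paid only once, since it is carried unchanged through the induction. -/
lemma measureReal_gridSurvival_le {Ω : Type*} [MeasurableSpace Ω] {P : Measure Ω}
    [IsProbabilityMeasure P] {a l ε μ σ : ℝ} (ha : 0 ≤ a) {v : ℝ≥0} (hv : (v : ℝ) = σ ^ 2) (hμ : μ = a * v) (hl : 2 * a ≤ l)
    (hε : 0 < ε) (δ : ℝ≥0) (n : ℕ) :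
    ∀ {W : ℝ≥0 → Ω → ℝ}, IsPreBrownianReal W P → ∀ {x : ℝ}, 0 ≤ x →
      P.real (gridSurvival W μ σ δ n x) ≤ surv a (n * (v * δ)) (x + ε)
        + n * Real.exp (-(l * ε) + l ^ 2 * (σ ^ 2 * δ) / 2) := by
  induction n with
  | zero =>
    intro W hW x hx
    simp [surv_zero_of_pos a (by linarith : 0 < x + ε), measureReal_le_one]
  | succ n ih =>
    intro W hW x hx
    set s : ℝ≥0 := v * δ with hs
    have hs' : (s : ℝ) = σ ^ 2 * δ := by rw [hs, NNReal.coe_mul, hv]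
    set η := Real.exp (-(l * ε) + l ^ 2 * (σ ^ 2 * δ) / 2) with hη
    have hη0 : 0 < η := Real.exp_pos _
    obtain ⟨hm, h⟩ := exists_gridSurvival_succ hW (μ := μ) hv δ n x
    have hdrift : x + μ * δ = x + a * s := by
      rw [hs', hμ, hv]; ring
    rw [h, ← hs, hdrift, show ((n + 1 : ℕ) : ℝ≥0) * s = s + n * s by push_cast; ring]
    have hstep := integral_indicator_surv_le (ε := ε) ha hl (n * s) s hx
    rw [hs', ← hη] at hstep
    have hi : Integrable (fun y => surv a (n * s) (y + ε)) (gaussianReal (x + a * s) s) := by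
      have := integrable_surv a (x + a * s + ε) (n * s) s
      rw [← gaussianReal_map_add_const] at this
      exact this.comp_measurable (by fun_prop)
    have hle : ∫ z, (Ioi 0).indicator (fun z => P.real
          (gridSurvival (fun t ω => W (δ + t) ω - W δ ω) μ σ δ n z)) z ∂gaussianReal (x + a * s) s
        ≤ ∫ z, ((Ioi 0).indicator (fun y => surv a (n * s) (y + ε)) z + n * η)
          ∂gaussianReal (x + a * s) s := by
      refine integral_mono (Integrable.indicator ((integrable_const (1 : ℝ)).mono'
        hm.aestronglyMeasurable (ae_of_all _ fun z => ?_)) measurableSet_Ioi)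
        ((hi.indicator measurableSet_Ioi).add (integrable_const _)) fun z => ?_
      · rw [Real.norm_of_nonneg measureReal_nonneg]
        exact measureReal_le_one
      · by_cases hz : 0 < z
        · simpa only [indicator, mem_Ioi, hz, if_true] using ih (hW.shift δ) hz.le
        · simp only [indicator, mem_Ioi, hz, if_false]
          positivity
    rw [integral_add (hi.indicator measurableSet_Ioi) (integrable_const _)] at hle
    simp only [integral_const, probReal_univ, smul_eq_mul, one_mul] at hle
    rw [hs'] at *
    push_cast
    linarith

/-! ### Standard normal functions and the mean of a positive part -/

/-- The density of the standard normal distribution. -/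
def stdPDF (x : ℝ) : ℝ := (Real.sqrt (2 * Real.pi))⁻¹ * Real.exp (-x ^ 2 / 2)

lemma stdPDF_eq (x : ℝ) : stdPDF x = gaussianPDFReal 0 1 x := by
  simp [stdPDF, gaussianPDFReal]

lemma hasDerivAt_stdPDF (x : ℝ) : HasDerivAt stdPDF (-x * stdPDF x) x := by
  have h : HasDerivAt (fun x : ℝ => -x ^ 2 / 2) (-x) x := by
    refine (((hasDerivAt_pow 2 x).neg).div_const 2).congr_deriv ?_
    norm_num
    ring
  refine (h.exp.const_mul (Real.sqrt (2 * Real.pi))⁻¹).congr_deriv ?_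
  rw [stdPDF]; ring

lemma integrable_stdPDF : Integrable stdPDF := by
  simp_rw [funext stdPDF_eq]; exact integrable_gaussianPDFReal 0 1

lemma stdPDF_neg (x : ℝ) : stdPDF (-x) = stdPDF x := by simp [stdPDF]

/-- The cumulative distribution function of the standard normal distribution. -/
def stdCDF (x : ℝ) : ℝ := (gaussianReal 0 1).real (Ioi (-x))

lemma stdCDF_eq (x : ℝ) : stdCDF x = ∫ z in Ioi (-x), stdPDF z := by
  rw [stdCDF, measureReal_def, gaussianReal_apply_eq_integral 0 one_ne_zero,
    ENNReal.toReal_ofReal (integral_nonneg fun _ => gaussianPDFReal_nonneg _ _ _)]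
  simp_rw [stdPDF_eq]

lemma continuous_stdPDF : Continuous stdPDF :=
  continuous_iff_continuousAt.2 fun x => (hasDerivAt_stdPDF x).continuousAt

lemma hasDerivAt_stdCDF (x : ℝ) : HasDerivAt stdCDF (stdPDF x) x := by
  have h : stdCDF = fun x => (∫ z in (-x)..0, stdPDF z) + ∫ z in Ioi (0 : ℝ), stdPDF z := by
    ext x
    rw [stdCDF_eq, intervalIntegral.integral_interval_add_Ioi integrable_stdPDF.integrableOn
      integrable_stdPDF.integrableOn]
  rw [h]
  have h1 : HasDerivAt (fun u => ∫ z in u..0, stdPDF z) (-stdPDF (-x)) (-x) :=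
    intervalIntegral.integral_hasDerivAt_left (continuous_stdPDF.intervalIntegrable _ _)
      (continuous_stdPDF.stronglyMeasurableAtFilter _ _) continuous_stdPDF.continuousAt
  refine ((h1.comp x (hasDerivAt_neg x)).add_const (∫ z in Ioi (0 : ℝ), stdPDF z)).congr_deriv ?_
  rw [stdPDF_neg]; ring

lemma map_stdGaussian (m : ℝ) (v : ℝ≥0) :
    (gaussianReal 0 1).map (fun z => m + Real.sqrt v * z) = gaussianReal m v := by
  have : (fun z => m + Real.sqrt v * z) = (fun w => m + w) ∘ (fun w => Real.sqrt v * w) := rfl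
  rw [this, ← Measure.map_map (by fun_prop) (by fun_prop), gaussianReal_map_const_mul,
    gaussianReal_map_const_add]
  congr 1
  · ring
  · refine NNReal.eq ?_
    rw [mul_one]
    exact Real.sq_sqrt v.2

lemma posMass_eq_stdCDF (m : ℝ) {v : ℝ≥0} (hv : v ≠ 0) :
    posMass m v = stdCDF (m / Real.sqrt v) := by
  have hs : 0 < Real.sqrt v := Real.sqrt_pos.2 (by positivity)
  rw [posMass, stdCDF, measureReal_def, measureReal_def, ← map_stdGaussian m v,
    Measure.map_apply (by fun_prop) measurableSet_Ioi]
  congr 2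
  ext z
  simp only [mem_preimage, mem_Ioi]
  rw [← neg_div, div_lt_iff₀ hs]
  constructor <;> intro h <;> nlinarith

/-- The expected positive part of a normal variable with mean `m` and standard deviation `s`. -/
def posPartMean (m s : ℝ) : ℝ := ∫ z, max (m + s * z) 0 ∂gaussianReal 0 1

lemma integrable_id_stdGaussian : Integrable (fun z : ℝ => z) (gaussianReal 0 1) :=
  memLp_one_iff_integrable.1 (memLp_id_gaussianReal' 1 (by simp))

lemma integrable_posPart (m s : ℝ) :
    Integrable (fun z : ℝ => max (m + s * z) 0) (gaussianReal 0 1) :=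
  ((integrable_const m).add (integrable_id_stdGaussian.const_mul s)).pos_part

lemma posPartMean_nonneg (m s : ℝ) : 0 ≤ posPartMean m s :=
  integral_nonneg fun _ => le_max_right _ _

/-- The first absolute moment of the standard normal distribution. -/
def stdAbsMean : ℝ := ∫ z, |z| ∂gaussianReal 0 1

/-- The positive part is 1-Lipschitz. The bound includes s = 0, which is what yields continuity of
`absorbedMean` down to time 0, where the closed form in terms of `stdCDF` breaks down. -/
lemma abs_posPartMean_sub_le (m s m' s' : ℝ) :
    |posPartMean m s - posPartMean m' s'| ≤ |m - m'| + |s - s'| * stdAbsMean := by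
  have h2 : Integrable (fun z : ℝ => |m - m'| + |s - s'| * |z|) (gaussianReal 0 1) :=
    (integrable_const _).add (integrable_id_stdGaussian.abs.const_mul _)
  have h3 : |m - m'| + |s - s'| * stdAbsMean
      = ∫ z, (|m - m'| + |s - s'| * |z|) ∂gaussianReal 0 1 := by
    rw [integral_add (integrable_const _) (integrable_id_stdGaussian.abs.const_mul _),
      integral_const_mul]
    simp [stdAbsMean]
  rw [posPartMean, posPartMean, ← integral_sub (integrable_posPart _ _) (integrable_posPart _ _),
    h3]
  refine (abs_integral_le_integral_abs).trans (integral_mono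
    ((integrable_posPart _ _).sub (integrable_posPart _ _)).abs h2 fun z => ?_)
  refine (abs_max_sub_max_le_abs _ _ _).trans ?_
  rw [show m + s * z - (m' + s' * z) = (m - m') + (s - s') * z by ring, ← abs_mul]
  exact abs_add_le _ _

lemma posPartMean_le (m s : ℝ) : posPartMean m s ≤ |m| + |s| * stdAbsMean := by
  have h := abs_posPartMean_sub_le m s 0 0
  have h0 : posPartMean 0 0 = 0 := by simp [posPartMean]
  rw [h0] at h
  simpa using (le_abs_self _).trans h

lemma stdAbsMean_nonneg : 0 ≤ stdAbsMean := integral_nonneg fun _ => abs_nonneg _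

lemma continuous_posPartMean : Continuous fun q : ℝ × ℝ => posPartMean q.1 q.2 := by
  rw [continuous_iff_continuousAt]
  intro q
  rw [ContinuousAt, tendsto_iff_dist_tendsto_zero]
  have h : Continuous fun r : ℝ × ℝ => |r.1 - q.1| + |r.2 - q.2| * stdAbsMean := by fun_prop
  have h' := h.tendsto q
  simp only [sub_self, abs_zero, zero_mul, add_zero] at h'
  exact squeeze_zero (fun _ => dist_nonneg) (fun r => by
    rw [Real.dist_eq]; exact abs_posPartMean_sub_le _ _ _ _) h'

lemma posPartMean_zero_right (m : ℝ) : posPartMean m 0 = max m 0 := by simp [posPartMean]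

lemma posPartMean_eq (m : ℝ) {s : ℝ} (hs : 0 < s) :
    posPartMean m s = m * stdCDF (m / s) + s * stdPDF (m / s) := by
  have hneg (z : ℝ) : 0 < m + s * z ↔ -(m / s) < z := by
    rw [← neg_div, div_lt_iff₀ hs]
    constructor <;> intro h <;> nlinarith
  have hder (z : ℝ) : HasDerivAt (fun z => -stdPDF z) (z * stdPDF z) z := by
    exact (hasDerivAt_stdPDF z).neg.congr_deriv (by ring)
  have hint : Integrable (fun z => z * stdPDF z) := by
    have := integrable_id_stdGaussian
    rw [gaussianReal_of_var_ne_zero _ one_ne_zero,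
      integrable_withDensity_iff_integrable_smul' (measurable_gaussianPDF _ _)
        (ae_of_all _ fun _ => gaussianPDF_lt_top)] at this
    refine this.congr (ae_of_all _ fun z => ?_)
    simp [toReal_gaussianPDF, stdPDF_eq, mul_comm]
  have hlim : Filter.Tendsto (fun z => -stdPDF z) Filter.atTop (nhds 0) := by
    have h1 : Filter.Tendsto (fun z : ℝ => -z ^ 2 / 2) Filter.atTop Filter.atBot := by
      have : Filter.Tendsto (fun z : ℝ => z ^ 2 / 2) Filter.atTop Filter.atTop :=
        (Filter.tendsto_pow_atTop two_ne_zero).atTop_div_const two_pos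
      refine (Filter.tendsto_neg_atTop_atBot.comp this).congr fun z => ?_
      simp [neg_div]
    have h2 := (Real.tendsto_exp_atBot.comp h1).const_mul (-(Real.sqrt (2 * Real.pi))⁻¹)
    rw [mul_zero] at h2
    refine h2.congr fun z => ?_
    simp [stdPDF]
  have h1 : ∫ z in Ioi (-(m / s)), z * stdPDF z = stdPDF (m / s) := by
    rw [integral_Ioi_of_hasDerivAt_of_tendsto' (fun z _ => hder z) hint.integrableOn hlim,
      stdPDF_neg]
    ring
  rw [posPartMean, integral_gaussianReal_eq_integral_smul one_ne_zero]
  have h2 : (fun z => gaussianPDFReal 0 1 z • max (m + s * z) 0)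
      = (Ioi (-(m / s))).indicator fun z => m * stdPDF z + s * (z * stdPDF z) := by
    ext z
    by_cases hz : -(m / s) < z
    · simp only [indicator, mem_Ioi, hz, if_true, smul_eq_mul, ← stdPDF_eq,
        max_eq_left ((hneg z).2 hz).le]
      ring
    · have : m + s * z ≤ 0 := not_lt.1 fun h => hz ((hneg z).1 h)
      simp [indicator, hz, max_eq_right this]
  rw [h2, integral_indicator measurableSet_Ioi, integral_add
    (integrable_stdPDF.integrableOn.const_mul _) (hint.integrableOn.const_mul _),
    integral_const_mul, integral_const_mul, h1, stdCDF_eq]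

/-- By φ'(x) = -xφ(x) all terms containing the derivative of m/s cancel, so the partial derivatives
in m and s are just Φ(m/s) and φ(m/s). -/
lemma hasDerivAt_posPartMean {m s : ℝ → ℝ} {m' s' y : ℝ} (hm : HasDerivAt m m' y)
    (hs : HasDerivAt s s' y) (hpos : ∀ᶠ z in nhds y, 0 < s z) :
    HasDerivAt (fun z => posPartMean (m z) (s z))
      (m' * stdCDF (m y / s y) + s' * stdPDF (m y / s y)) y := by
  have hy : 0 < s y := hpos.self_of_nhds
  have hq := hm.div hs hy.ne'
  have h := (hm.mul ((hasDerivAt_stdCDF _).comp y hq)).add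
    (hs.mul ((hasDerivAt_stdPDF _).comp y hq))
  have h' := h.congr_of_eventuallyEq (f₁ := fun z => posPartMean (m z) (s z))
    (by filter_upwards [hpos] with z hz using posPartMean_eq _ hz)
  refine h'.congr_deriv ?_
  simp only [Function.comp_apply, Pi.div_apply]
  field_simp
  ring

lemma posPartMean_sqrt (m : ℝ) (v : ℝ≥0) :
    posPartMean m (Real.sqrt v) = ∫ y, max y 0 ∂gaussianReal m v := by
  rw [← map_stdGaussian m v, integral_map (by fun_prop) (by fun_prop)]
  rfl

/-! ### From grid survival to the ruin probability -/

lemma continuous_surv (a : ℝ) {τ : ℝ≥0} (hτ : τ ≠ 0) : Continuous (surv a τ) := by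
  have hc : Continuous stdCDF :=
    continuous_iff_continuousAt.2 fun x => (hasDerivAt_stdCDF x).continuousAt
  have : surv a τ = fun x => stdCDF ((x + a * τ) / Real.sqrt τ)
      - Real.exp (-2 * a * x) * stdCDF ((a * τ - x) / Real.sqrt τ) := by
    ext x
    rw [surv, posMass_eq_stdCDF _ hτ, posMass_eq_stdCDF _ hτ]
  rw [this]
  fun_prop

lemma nullMeasurableSet_gridSurvival {Ω : Type*} [MeasurableSpace Ω] {P : Measure Ω}
    {W : ℝ≥0 → Ω → ℝ} (hW : IsPreBrownianReal W P) (μ σ : ℝ) (δ : ℝ≥0) (n : ℕ) (x : ℝ) :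
    NullMeasurableSet (gridSurvival W μ σ δ n x) P := by
  have : gridSurvival W μ σ δ n x
      = ⋂ k : ℕ, ⋂ _ : k < n, {ω | 0 < diffusion W μ σ x ((k + 1) * δ) ω} := by
    ext ω; simp [gridSurvival]
  rw [this]
  refine NullMeasurableSet.iInter fun k => NullMeasurableSet.iInter fun _ => ?_
  refine nullMeasurableSet_lt aemeasurable_const ?_
  exact aemeasurable_const.add ((hW.aemeasurable _).const_mul σ)

lemma ae_diffusion_ne_zero {Ω : Type*} [MeasurableSpace Ω] {P : Measure Ω}
    {W : ℝ≥0 → Ω → ℝ} (hW : IsPreBrownianReal W P) (μ x : ℝ) {σ : ℝ} (hσ : σ ≠ 0) {T : ℝ≥0}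
    (hT : T ≠ 0) : ∀ᵐ ω ∂P, diffusion W μ σ x T ω ≠ 0 := by
  have := nullSingletonClass_gaussianReal (μ := 0) hT
  have h : ∀ᵐ w ∂gaussianReal 0 T, w ≠ -(x + μ * T) / σ := by
    rw [ae_iff]; simp
  rw [← (hW.hasLaw_eval T).map_eq] at h
  filter_upwards [ae_of_ae_map (hW.aemeasurable T) h] with ω hω h0
  apply hω
  rw [diffusion] at h0
  field_simp
  linarith

lemma continuous_diffusion {Ω : Type*} {W : ℝ≥0 → Ω → ℝ} {ω : Ω} (h : Continuous (W · ω))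
    (μ σ x : ℝ) : Continuous (diffusion W μ σ x · ω) := by
  unfold diffusion
  fun_prop

lemma ruinProb_eq_hit {Ω : Type*} [MeasurableSpace Ω] (P : Measure Ω) (W : ℝ≥0 → Ω → ℝ)
    (μ σ x t : ℝ) : ruinProb P W μ σ x t
      = P.real {ω | ∃ s < t.toNNReal, diffusion W μ σ x s ω = 0} := by
  unfold ruinProb
  congr 1
  ext ω
  simp only [mem_ofPred_eq, hittingAfter_lt_iff]
  simp

/-- By continuity a path that never hits 0 before T is positive at every grid time; the last grid
time is T itself, where the path is almost surely nonzero. The upper bound for grid survival then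
applies on finer and finer grids. -/
lemma one_sub_measureReal_hit_le {Ω : Type*} [MeasurableSpace Ω] {P : Measure Ω}
    [IsProbabilityMeasure P] {W : ℝ≥0 → Ω → ℝ} (hW : IsBrownianReal W P) {a μ σ : ℝ} (ha : 0 ≤ a)
    {v : ℝ≥0} (hv0 : v ≠ 0) (hv : (v : ℝ) = σ ^ 2) (hμ : μ = a * v) {T : ℝ≥0} (hT : T ≠ 0)
    {x : ℝ} (hx : 0 < x) :
    1 - P.real {ω | ∃ s < T, diffusion W μ σ x s ω = 0} ≤ surv a (v * T) x := by
  have hσ : σ ≠ 0 := by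
    rintro rfl
    exact hv0 (NNReal.eq (by simpa using hv))
  set E : Set Ω := {ω | ∃ s < T, diffusion W μ σ x s ω = 0}
  have hgrid (n : ℕ) (hn : n ≠ 0) : 1 - P.real E ≤ P.real (gridSurvival W μ σ (T / n) n x) := by
    have h1 : P.real Eᶜ ≤ P.real (gridSurvival W μ σ (T / n) n x) := by
      refine ENNReal.toReal_mono (measure_ne_top _ _) (measure_mono_ae ?_)
      filter_upwards [hW.cont, hW.eval_zero_ae_eq_zero,
        ae_diffusion_ne_zero hW.toIsPreBrownianReal μ x hσ hT] with ω hc h0 hne hω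
      change ω ∈ Eᶜ at hω
      change ∀ k < n, 0 < diffusion W μ σ x ((k + 1) * (T / n)) ω
      intro k hk
      have hle : (k + 1 : ℝ≥0) * (T / n) ≤ T := by
        have hk' : (k + 1 : ℝ≥0) ≤ n := by exact_mod_cast hk
        calc (k + 1 : ℝ≥0) * (T / n) ≤ n * (T / n) := by gcongr
          _ = T := mul_div_cancel₀ _ (by exact_mod_cast hn)
      by_contra hcon
      rw [not_lt] at hcon
      have hzero : diffusion W μ σ x 0 ω = x := by simp [diffusion, h0]
      obtain ⟨s, hs, hs0⟩ := intermediate_value_Icc' (a := (0 : ℝ≥0))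
        (b := (k + 1 : ℝ≥0) * (T / n)) zero_le
        (continuous_diffusion hc μ σ x).continuousOn ⟨hcon, by simpa [hzero] using hx.le⟩
      rcases (hs.2.trans hle).lt_or_eq with h | rfl
      · exact hω ⟨s, h, hs0⟩
      · exact hne hs0
    have h2 : (1 : ℝ) ≤ P.real E + P.real Eᶜ := by
      rw [← probReal_univ (μ := P), ← union_compl_self E]
      exact measureReal_union_le _ _
    linarith
  have hε (ε : ℝ) (hε : 0 < ε) : 1 - P.real E ≤ surv a (v * T) (x + ε) := by
    -- With N² steps and exponent l = N, the variance term l²σ²δ/2 stays at σ²T/2, so the total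
    -- error is N² e^{-Nε} up to a constant and vanishes.
    have hlim : Filter.Tendsto (fun N : ℕ => surv a (v * T) (x + ε) +
        Real.exp (σ ^ 2 * T / 2) / ε ^ 2 * ((N * ε) ^ 2 * Real.exp (-(N * ε))))
        Filter.atTop (nhds (surv a (v * T) (x + ε))) := by
      have h1 : Filter.Tendsto (fun N : ℕ => (N : ℝ) * ε) Filter.atTop Filter.atTop :=
        tendsto_natCast_atTop_atTop.atTop_mul_const hε
      have h2 := (Real.tendsto_pow_mul_exp_neg_atTop_nhds_zero 2).comp h1
      simpa using (h2.const_mul (Real.exp (σ ^ 2 * T / 2) / ε ^ 2)).const_add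
        (surv a (v * T) (x + ε))
    refine ge_of_tendsto hlim ?_
    filter_upwards [Filter.eventually_ge_atTop ⌈2 * a⌉₊, Filter.eventually_gt_atTop 0] with N hN hN0
    have hN' : (0 : ℝ) < N := by exact_mod_cast hN0
    have h := hgrid (N ^ 2) (by positivity)
    have h2 := measureReal_gridSurvival_le (P := P) ha hv hμ (Nat.ceil_le.1 hN) hε
      (T / (N ^ 2 : ℕ)) (N ^ 2) hW.toIsPreBrownianReal hx.le
    have h3 : ((N ^ 2 : ℕ) : ℝ≥0) * (v * (T / (N ^ 2 : ℕ))) = v * T := by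
      have : ((N ^ 2 : ℕ) : ℝ≥0) ≠ 0 := by positivity
      field_simp
    rw [h3] at h2
    refine (h.trans h2).trans (le_of_eq ?_)
    have h4 : -((N : ℝ) * ε) + (N : ℝ) ^ 2 * (σ ^ 2 * ((T / (N ^ 2 : ℕ) : ℝ≥0) : ℝ)) / 2
        = σ ^ 2 * T / 2 + -(N * ε) := by
      push_cast
      field_simp
      ring
    rw [h4, Real.exp_add]
    push_cast
    field_simp
  have hcont := continuous_surv a (mul_ne_zero hv0 hT)
  have hlim : Filter.Tendsto (fun ε => surv a (v * T) (x + ε)) (nhdsWithin 0 (Ioi 0))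
      (nhds (surv a (v * T) x)) := by
    have : Continuous fun ε => surv a (v * T) (x + ε) := by fun_prop
    simpa using (this.tendsto 0).mono_left nhdsWithin_le_nhds
  exact ge_of_tendsto hlim (by filter_upwards [self_mem_nhdsWithin] with ε h using hε ε h)

/-- If the path from x reaches 0, the path from x - ε is negative at that time, hence by continuity
also at a nearby dyadic time. Hitting thus forces failure of grid survival from x - ε on some dyadic
grid. -/
lemma measureReal_hit_le {Ω : Type*} [MeasurableSpace Ω] {P : Measure Ω}
    [IsProbabilityMeasure P] {W : ℝ≥0 → Ω → ℝ} (hW : IsBrownianReal W P) {a μ σ : ℝ} (ha : 0 ≤ a)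
    {v : ℝ≥0} (hv0 : v ≠ 0) (hv : (v : ℝ) = σ ^ 2) (hμ : μ = a * v) {T : ℝ≥0} (hT : T ≠ 0)
    {x : ℝ} (hx : 0 < x) :
    P.real {ω | ∃ s < T, diffusion W μ σ x s ω = 0} ≤ 1 - surv a (v * T) x := by
  have hε (ε : ℝ) (hε : 0 < ε) (hεx : ε < x) :
      P.real {ω | ∃ s < T, diffusion W μ σ x s ω = 0} ≤ 1 - surv a (v * T) (x - ε) := by
    let B : ℕ → Set Ω := fun N => (gridSurvival W μ σ (T / 2 ^ N) (2 ^ N) (x - ε))ᶜ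
    have hmono : Monotone B := by
      -- Dyadic grids are nested: the k-th time of one grid (counted from 0) has index 2k + 1 in the
      -- next.
      refine monotone_nat_of_le_succ fun N => compl_subset_compl.2 fun ω hω k hk => ?_
      have := hω (2 * k + 1) (by rw [pow_succ]; omega)
      convert this using 2
      rw [pow_succ]
      push_cast
      field_simp
      ring
    have hB (N : ℕ) : P.real (B N) ≤ 1 - surv a (v * T) (x - ε) := by
      rw [probReal_compl_eq_one_sub₀
        (nullMeasurableSet_gridSurvival hW.toIsPreBrownianReal _ _ _ _ _)]
      have := surv_le_measureReal_gridSurvival (P := P) ha hv hμ (T / 2 ^ N) (2 ^ N)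
        hW.toIsPreBrownianReal (x := x - ε) (by linarith)
      rw [show ((2 ^ N : ℕ) : ℝ≥0) * (v * (T / 2 ^ N)) = v * T by push_cast; field_simp] at this
      linarith
    have hlim : Filter.Tendsto (fun N => P.real (B N)) Filter.atTop (nhds (P.real (⋃ N, B N))) :=
      (ENNReal.tendsto_toReal (measure_ne_top _ _)).comp (tendsto_measure_iUnion_atTop hmono)
    refine le_trans ?_ (le_of_tendsto' hlim hB)
    refine ENNReal.toReal_mono (measure_ne_top _ _) (measure_mono_ae ?_)
    filter_upwards [hW.cont, hW.eval_zero_ae_eq_zero] with ω hc h0 hω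
    obtain ⟨s, hs, hs0⟩ : ∃ s < T, diffusion W μ σ x s ω = 0 := hω
    have hneg : diffusion W μ σ (x - ε) s ω < 0 := by
      simp only [diffusion] at hs0 ⊢; linarith
    have hT' : (0 : ℝ) < T := by positivity
    have hsT : (s : ℝ) / T < 1 := by
      rw [div_lt_one hT']; exact_mod_cast hs
    have hseq : Filter.Tendsto
        (fun N : ℕ => (⌈(s : ℝ) / T * 2 ^ N⌉₊ : ℝ≥0) * (T / 2 ^ N)) Filter.atTop (nhds s) := by
      rw [← NNReal.tendsto_coe]
      have h1 := (tendsto_nat_ceil_mul_div_atTop (R := ℝ) (a := s / T) (by positivity)).comp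
        (tendsto_pow_atTop_atTop_of_one_lt (one_lt_two : (1 : ℝ) < 2))
      have h2 := h1.mul_const (T : ℝ)
      rw [div_mul_cancel₀ _ hT'.ne'] at h2
      refine h2.congr fun N => ?_
      push_cast
      simp only [Function.comp_apply]
      ring
    have hev := ((continuous_diffusion hc μ σ (x - ε)).tendsto s).comp hseq
    obtain ⟨N, hN⟩ := (hev.eventually_lt_const hneg).exists
    change ω ∈ ⋃ N, B N
    refine mem_iUnion.2 ⟨N, fun hω => ?_⟩
    simp only [Function.comp_apply] at hN
    -- Time 0 is not a grid time, but there the path is at x - ε > 0 and cannot be negative.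
    rcases Nat.eq_zero_or_pos ⌈(s : ℝ) / T * 2 ^ N⌉₊ with hk | hk
    · rw [hk] at hN
      simp [diffusion, h0] at hN
      linarith
    · have hle : ⌈(s : ℝ) / T * 2 ^ N⌉₊ ≤ 2 ^ N := by
        refine Nat.ceil_le.2 ?_
        push_cast
        exact mul_le_of_le_one_left (by positivity) hsT.le
      have := hω (⌈(s : ℝ) / T * 2 ^ N⌉₊ - 1) (by omega)
      have hcast : ((⌈(s : ℝ) / T * 2 ^ N⌉₊ - 1 : ℕ) : ℝ≥0) + 1 = (⌈(s : ℝ) / T * 2 ^ N⌉₊ : ℝ≥0) := by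
        exact_mod_cast Nat.sub_add_cancel hk
      rw [hcast] at this
      linarith
  have hcont := continuous_surv a (mul_ne_zero hv0 hT)
  have hlim : Filter.Tendsto (fun ε => 1 - surv a (v * T) (x - ε)) (nhdsWithin 0 (Ioi 0))
      (nhds (1 - surv a (v * T) x)) := by
    have : Continuous fun ε => 1 - surv a (v * T) (x - ε) := by fun_prop
    simpa using (this.tendsto 0).mono_left nhdsWithin_le_nhds
  exact ge_of_tendsto hlim
    (by filter_upwards [Ioo_mem_nhdsGT hx] with ε h using hε ε h.1 h.2)

lemma surv_zero_right (a : ℝ) (τ : ℝ≥0) : surv a τ 0 = 0 := by simp [surv]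

/-- The ruin probability in closed form. -/
lemma ruinProb_eq {Ω : Type*} [MeasurableSpace Ω] {P : Measure Ω}
    [IsProbabilityMeasure P] {W : ℝ≥0 → Ω → ℝ} (hW : IsBrownianReal W P) {a μ σ : ℝ} (ha : 0 ≤ a)
    {v : ℝ≥0} (hv0 : v ≠ 0) (hv : (v : ℝ) = σ ^ 2) (hμ : μ = a * v) {t : ℝ} (ht : 0 < t)
    {x : ℝ} (hx : 0 ≤ x) :
    ruinProb P W μ σ x t = 1 - surv a (v * t.toNNReal) x := by
  have hT : t.toNNReal ≠ 0 := by simpa using ht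
  rw [ruinProb_eq_hit]
  rcases hx.eq_or_lt with rfl | hx
  · rw [surv_zero_right, sub_zero, ← probReal_univ (μ := P)]
    refine congrArg ENNReal.toReal (measure_congr ?_)
    filter_upwards [hW.eval_zero_ae_eq_zero] with ω h0
    refine propext ⟨fun _ => trivial, fun _ => ⟨0, by positivity, ?_⟩⟩
    simp [diffusion, h0]
  · have h1 := one_sub_measureReal_hit_le hW ha hv0 hv hμ hT hx
    have h2 := measureReal_hit_le hW ha hv0 hv hμ hT hx
    linarith

/-! ### Comparison principle on the quarter-plane -/

/-- A positive second derivative would make the point a local minimum as well, so f would be locally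
constant, a contradiction. -/
lemma deriv_deriv_nonpos_of_isLocalMax {f : ℝ → ℝ} {x : ℝ} (hf : ContinuousAt f x)
    (h : IsLocalMax f x) : deriv (deriv f) x ≤ 0 := by
  by_contra hcon
  rw [not_le] at hcon
  have hmin := isLocalMin_of_deriv_deriv_pos hcon h.deriv_eq_zero hf
  have hconst : f =ᶠ[nhds x] fun _ => f x := by
    filter_upwards [h, hmin] with y h1 h2 using le_antisymm h1 h2
  have h1 := hconst.deriv.deriv_eq
  simp at h1
  linarith

lemma eventually_differentiableAt_of_contDiffAt {f : ℝ → ℝ} {x : ℝ} (hf : ContDiffAt ℝ 2 f x) :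
    ∀ᶠ y in nhds x, DifferentiableAt ℝ f y := by
  filter_upwards [hf.eventually (by simp)] with y hy using hy.differentiableAt (by norm_num)

lemma differentiableAt_deriv_of_contDiffAt {f : ℝ → ℝ} {x : ℝ} (hf : ContDiffAt ℝ 2 f x) :
    DifferentiableAt ℝ (deriv f) x :=
  ((hf.fderiv_right (m := 1) (by norm_num)).differentiableAt (by norm_num)).clm_apply
    (differentiableAt_const 1)

lemma gen_sub {μ σ x : ℝ} {f g : ℝ → ℝ} (hf : ContDiffAt ℝ 2 f x) (hg : ContDiffAt ℝ 2 g x) :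
    gen μ σ (fun y => f y - g y) x = gen μ σ f x - gen μ σ g x := by
  have h1 : deriv (fun y => f y - g y) =ᶠ[nhds x] fun y => deriv f y - deriv g y := by
    filter_upwards [eventually_differentiableAt_of_contDiffAt hf,
      eventually_differentiableAt_of_contDiffAt hg] with y h1 h2 using deriv_fun_sub h1 h2
  unfold gen
  rw [h1.deriv_eq, h1.self_of_nhds, deriv_fun_sub (differentiableAt_deriv_of_contDiffAt hf)
    (differentiableAt_deriv_of_contDiffAt hg)]
  ring

lemma deriv_nonneg_of_left_le {g : ℝ → ℝ} {g' t : ℝ} (hg : HasDerivAt g g' t)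
    (h : ∀ᶠ s in nhdsWithin t (Iio t), g s ≤ g t) : 0 ≤ g' := by
  have h1 := (hasDerivWithinAt_iff_tendsto_slope' (s := Iio t) (by simp)).1
    (hg.hasDerivWithinAt (s := Iio t))
  refine ge_of_tendsto h1 ?_
  filter_upwards [h, self_mem_nhdsWithin] with s hs hst
  rw [slope_def_field]
  exact div_nonneg_of_nonpos (by linarith) (by rw [mem_Iio] at hst; linarith)

/-- The comparison function in the maximum principle on the quarter-plane. -/
def barrier (k ε : ℝ) (x t : ℝ) : ℝ := ε * Real.exp (k * t) * (1 + x ^ 2)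

lemma gen_barrier (μ σ k ε x t : ℝ) : gen μ σ (fun y => barrier k ε y t) x
    = ε * Real.exp (k * t) * (σ ^ 2 + 2 * μ * x) := by
  have h1 : deriv (fun y => barrier k ε y t) = fun y => ε * Real.exp (k * t) * (2 * y) := by
    ext y
    have : HasDerivAt (fun y => barrier k ε y t) (ε * Real.exp (k * t) * (2 * y)) y := by
      refine (((hasDerivAt_pow 2 y).const_add 1).const_mul _).congr_deriv ?_
      norm_num
    exact this.deriv
  unfold gen
  rw [h1, deriv_const_mul _ (by fun_prop), deriv_const_mul _ (by fun_prop), deriv_id'']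
  ring

/-- The corner is covered by neither the boundary nor the initial condition; continuity supplies its
value. -/
lemma IsDirichletSolution.zero_zero {μ σ : ℝ} {h : ℝ → ℝ → ℝ} (hh : IsDirichletSolution μ σ h) :
    h 0 0 = 0 := by
  have h1 := hh.continuousOn (0, 0) (by simp)
  have h2 : Filter.Tendsto (fun t : ℝ => ((0 : ℝ), t)) (nhdsWithin 0 (Ioi 0))
      (nhdsWithin (0, 0) (Ici 0 ×ˢ Ici 0)) := by
    refine tendsto_nhdsWithin_iff.2 ⟨?_, ?_⟩
    · exact ((by fun_prop : Continuous fun t : ℝ => ((0 : ℝ), t)).tendsto 0).mono_left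
        nhdsWithin_le_nhds
    · filter_upwards [self_mem_nhdsWithin] with t ht
      exact ⟨self_mem_Ici, Ioi_subset_Ici_self ht⟩
  refine tendsto_nhds_unique (Filter.Tendsto.comp h1 h2) ?_
  refine tendsto_const_nhds.congr' ?_
  filter_upwards [self_mem_nhdsWithin] with t ht
  exact (hh.boundary t ht).symm

/-- The comparison principle for the Dirichlet problem on the quarter-plane. -/
lemma IsDirichletSolution.le {μ σ : ℝ} (hμ : 0 ≤ μ) {h₁ h₂ : ℝ → ℝ → ℝ}
    (hh₁ : IsDirichletSolution μ σ h₁) (hh₂ : IsDirichletSolution μ σ h₂) {x t : ℝ}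
    (hx : 0 ≤ x) (ht : 0 ≤ t) : h₁ x t ≤ h₂ x t := by
  obtain ⟨C₁, hC₁⟩ := hh₁.growth t
  obtain ⟨C₂, hC₂⟩ := hh₂.growth t
  -- This rate makes the barrier a strict supersolution, because 2μx ≤ μ(1 + x²).
  set k := σ ^ 2 + μ + 1 with hk
  have key (ε : ℝ) (hε : 0 < ε) : h₁ x t - h₂ x t - barrier k ε x t ≤ 0 := by
    set f : ℝ × ℝ → ℝ := fun q => h₁ q.1 q.2 - h₂ q.1 q.2 - barrier k ε q.1 q.2 with hf
    set C := |C₁| + |C₂| with hC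
    -- Beyond R the quadratic barrier dominates the linear growth of both solutions, so a positive
    -- maximum cannot lie on the right side of the rectangle.
    set R := x + 1 + 2 * C / ε with hR
    have hC0 : 0 ≤ C := by positivity
    have hR1 : 1 ≤ R := by
      have : 0 ≤ 2 * C / ε := by positivity
      linarith
    have hexp (s : ℝ) (hs : 0 ≤ s) : 1 ≤ Real.exp (k * s) :=
      Real.one_le_exp (by positivity)
    have hcompact : IsCompact (Icc 0 R ×ˢ Icc 0 t : Set (ℝ × ℝ)) := isCompact_Icc.prod isCompact_Icc
    have hcont : ContinuousOn f (Icc 0 R ×ˢ Icc 0 t) := by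
      have hsub : (Icc 0 R ×ˢ Icc 0 t : Set (ℝ × ℝ)) ⊆ Ici 0 ×ˢ Ici 0 :=
        prod_mono Icc_subset_Ici_self Icc_subset_Ici_self
      refine ((hh₁.continuousOn.mono hsub).sub (hh₂.continuousOn.mono hsub)).sub ?_
      unfold barrier
      fun_prop
    have hmem : (x, t) ∈ (Icc 0 R ×ˢ Icc 0 t : Set (ℝ × ℝ)) := by
      have : 0 ≤ 2 * C / ε := by positivity
      exact ⟨⟨hx, by simp only; linarith⟩, ⟨ht, le_rfl⟩⟩
    obtain ⟨⟨x₁, t₁⟩, ⟨hx₁, ht₁⟩, hmax⟩ := hcompact.exists_isMaxOn ⟨_, hmem⟩ hcont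
    simp only at hx₁ ht₁
    by_contra hcon
    rw [not_le] at hcon
    have hpos : 0 < f (x₁, t₁) := lt_of_lt_of_le hcon (hmax hmem)
    have hb (y s : ℝ) : 0 < barrier k ε y s := by unfold barrier; positivity
    have ht₁0 : 0 < t₁ := by
      rcases ht₁.1.eq_or_lt with h | h
      · exfalso
        rcases hx₁.1.eq_or_lt with h' | h'
        · simp only [hf, ← h, ← h', hh₁.zero_zero, hh₂.zero_zero] at hpos
          linarith [hb 0 0]
        · simp only [hf, ← h, hh₁.initial x₁ h', hh₂.initial x₁ h'] at hpos
          linarith [hb x₁ 0]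
      · exact h
    have hx₁0 : 0 < x₁ := by
      rcases hx₁.1.eq_or_lt with h | h
      · exfalso
        simp only [hf, ← h, hh₁.boundary t₁ ht₁0, hh₂.boundary t₁ ht₁0] at hpos
        linarith [hb 0 t₁]
      · exact h
    have hx₁R : x₁ < R := by
      refine lt_of_le_of_ne hx₁.2 fun h => ?_
      have e1 := hC₁ x₁ t₁ hx₁.1 ht₁.1 ht₁.2
      have e2 := hC₂ x₁ t₁ hx₁.1 ht₁.1 ht₁.2
      have e3 : |h₁ x₁ t₁| ≤ |C₁| * (1 + x₁) :=
        e1.trans (mul_le_mul_of_nonneg_right (le_abs_self _) (by linarith))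
      have e4 : |h₂ x₁ t₁| ≤ |C₂| * (1 + x₁) :=
        e2.trans (mul_le_mul_of_nonneg_right (le_abs_self _) (by linarith))
      have e5 : ε * (1 + x₁ ^ 2) ≤ barrier k ε x₁ t₁ := by
        unfold barrier
        have := hexp t₁ ht₁.1
        have h0 : 0 ≤ ε * (1 + x₁ ^ 2) := by positivity
        nlinarith
      have e6 : 2 * C ≤ ε * x₁ := by
        have : ε * (2 * C / ε) = 2 * C := by field_simp
        rw [h, hR]
        nlinarith
      have e7 : C * (1 + x₁) ≤ ε * x₁ * x₁ := by
        have h1x : 1 ≤ x₁ := h ▸ hR1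
        nlinarith
      have hpos' : 0 < h₁ x₁ t₁ - h₂ x₁ t₁ - barrier k ε x₁ t₁ := hpos
      rw [hC] at e7
      nlinarith [le_abs_self (h₁ x₁ t₁), neg_abs_le (h₂ x₁ t₁)]
    have c₁ := hh₁.contDiffAt x₁ t₁ hx₁0 ht₁0
    have c₂ := hh₂.contDiffAt x₁ t₁ hx₁0 ht₁0
    have cb : ContDiffAt ℝ 2 (fun y => barrier k ε y t₁) x₁ := by
      unfold barrier
      fun_prop
    have c12 : ContDiffAt ℝ 2 (fun y => h₁ y t₁ - h₂ y t₁) x₁ := c₁.sub c₂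
    have cf : ContDiffAt ℝ 2 (fun y => f (y, t₁)) x₁ := c12.sub cb
    have hlocal : IsLocalMax (fun y => f (y, t₁)) x₁ := by
      filter_upwards [Ioo_mem_nhds hx₁0 hx₁R] with y hy
      exact hmax ⟨⟨hy.1.le, hy.2.le⟩, ht₁⟩
    have hgen : gen μ σ (fun y => f (y, t₁)) x₁ ≤ 0 := by
      unfold gen
      rw [hlocal.deriv_eq_zero]
      have := deriv_deriv_nonpos_of_isLocalMax cf.continuousAt hlocal
      nlinarith [sq_nonneg σ]
    have hgen' : gen μ σ (fun y => f (y, t₁)) x₁ = gen μ σ (fun y => h₁ y t₁) x₁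
        - gen μ σ (fun y => h₂ y t₁) x₁ - gen μ σ (fun y => barrier k ε y t₁) x₁ := by
      rw [← gen_sub c₁ c₂, ← gen_sub c12 cb]
    have hbt : HasDerivAt (fun s => barrier k ε x₁ s) (k * barrier k ε x₁ t₁) t₁ := by
      have h1 : HasDerivAt (fun s : ℝ => k * s) k t₁ := by
        simpa using (hasDerivAt_id t₁).const_mul k
      refine ((h1.exp.const_mul ε).mul_const (1 + x₁ ^ 2)).congr_deriv ?_
      unfold barrier
      ring
    have hdt : HasDerivAt (fun s => f (x₁, s)) _ t₁ :=
      ((hh₁.hasDerivAt x₁ t₁ hx₁0 ht₁0).sub (hh₂.hasDerivAt x₁ t₁ hx₁0 ht₁0)).sub hbt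
    -- The maximum may sit at the final time, so only times before t₁ are compared.
    have hdt0 := deriv_nonneg_of_left_le hdt (by
      filter_upwards [Ioo_mem_nhdsLT ht₁0] with s hs
      exact hmax ⟨hx₁, ⟨hs.1.le, hs.2.le.trans ht₁.2⟩⟩)
    rw [hgen', gen_barrier] at hgen
    have hstrict : ε * Real.exp (k * t₁) * (σ ^ 2 + 2 * μ * x₁) < k * barrier k ε x₁ t₁ := by
      unfold barrier
      have h0 : 0 < ε * Real.exp (k * t₁) := by positivity
      have h1 : σ ^ 2 + 2 * μ * x₁ < k * (1 + x₁ ^ 2) := by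
        rw [hk]
        nlinarith [sq_nonneg (x₁ - 1), mul_nonneg hμ (sq_nonneg (x₁ - 1)),
          mul_nonneg (sq_nonneg σ) (sq_nonneg x₁)]
      nlinarith [mul_lt_mul_of_pos_left h1 h0]
    linarith
  have hlim : Filter.Tendsto (fun ε => h₁ x t - h₂ x t - barrier k ε x t) (nhdsWithin 0 (Ioi 0))
      (nhds (h₁ x t - h₂ x t)) := by
    have : Continuous fun ε => h₁ x t - h₂ x t - barrier k ε x t := by
      unfold barrier
      fun_prop
    simpa [barrier] using (this.tendsto 0).mono_left nhdsWithin_le_nhds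
  have := le_of_tendsto hlim (by filter_upwards [self_mem_nhdsWithin] with ε h using key ε h)
  linarith

/-! ### The explicit Dirichlet solution by images -/

/-- The mean at the time `t` of Brownian motion with drift `a * σ ^ 2` and volatility `σ`, started
at `x` and absorbed at `0`. -/
def absorbedMean (a σ x t : ℝ) : ℝ :=
  posPartMean (x + a * σ ^ 2 * t) (σ * Real.sqrt t)
    - Real.exp (-2 * a * x) * posPartMean (a * σ ^ 2 * t - x) (σ * Real.sqrt t)

lemma continuous_absorbedMean (a σ : ℝ) :
    Continuous fun q : ℝ × ℝ => absorbedMean a σ q.1 q.2 := by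
  unfold absorbedMean
  have h1 : Continuous fun q : ℝ × ℝ =>
      posPartMean (q.1 + a * σ ^ 2 * q.2) (σ * Real.sqrt q.2) :=
    continuous_posPartMean.comp
      (by fun_prop : Continuous fun q : ℝ × ℝ => (q.1 + a * σ ^ 2 * q.2, σ * Real.sqrt q.2))
  have h2 : Continuous fun q : ℝ × ℝ =>
      posPartMean (a * σ ^ 2 * q.2 - q.1) (σ * Real.sqrt q.2) :=
    continuous_posPartMean.comp
      (by fun_prop : Continuous fun q : ℝ × ℝ => (a * σ ^ 2 * q.2 - q.1, σ * Real.sqrt q.2))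
  exact h1.sub (Continuous.mul (by fun_prop) h2)

lemma contDiff_stdPDF {n : WithTop ℕ∞} : ContDiff ℝ n stdPDF := by
  unfold stdPDF
  fun_prop

lemma contDiff_stdCDF : ContDiff ℝ 2 stdCDF := by
  have hd : deriv stdCDF = stdPDF := funext fun x => (hasDerivAt_stdCDF x).deriv
  rw [show (2 : WithTop ℕ∞) = 1 + 1 by norm_num, contDiff_succ_iff_deriv]
  exact ⟨fun x => (hasDerivAt_stdCDF x).differentiableAt, by simp, hd ▸ contDiff_stdPDF⟩

lemma contDiff_posPartMean {s : ℝ} (hs : 0 < s) : ContDiff ℝ 2 fun m => posPartMean m s := by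
  simp_rw [posPartMean_eq _ hs]
  have h1 : ContDiff ℝ 2 fun m => stdCDF (m / s) := contDiff_stdCDF.comp (by fun_prop)
  have h2 : ContDiff ℝ 2 fun m => stdPDF (m / s) := contDiff_stdPDF.comp (by fun_prop)
  fun_prop

lemma contDiff_absorbedMean (a : ℝ) {σ t : ℝ} (hσ : 0 < σ) (ht : 0 < t) :
    ContDiff ℝ 2 fun x => absorbedMean a σ x t := by
  have hs : 0 < σ * Real.sqrt t := by positivity
  have h1 : ContDiff ℝ 2 fun x => posPartMean (x + a * σ ^ 2 * t) (σ * Real.sqrt t) :=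
    (contDiff_posPartMean hs).comp (by fun_prop)
  have h2 : ContDiff ℝ 2 fun x => posPartMean (a * σ ^ 2 * t - x) (σ * Real.sqrt t) :=
    (contDiff_posPartMean hs).comp (by fun_prop)
  unfold absorbedMean
  fun_prop

/-- The two image terms satisfy the equation separately: the factor e^{-2ax} conjugates drift a into
drift -a. Their difference is needed only for the boundary value. -/
lemma gen_absorbedMean (a : ℝ) {σ t : ℝ} (hσ : 0 < σ) (ht : 0 < t) (x : ℝ) :
    HasDerivAt (fun t => absorbedMean a σ x t)
      (gen (a * σ ^ 2) σ (fun y => absorbedMean a σ y t) x) t := by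
  set s : ℝ := σ * Real.sqrt t with hs_def
  have hs : 0 < s := by positivity
  have hs2 : s ^ 2 = σ ^ 2 * t := by rw [hs_def, mul_pow, Real.sq_sqrt ht.le]
  have hE (y : ℝ) : HasDerivAt (fun y => Real.exp (-2 * a * y))
      (-2 * a * Real.exp (-2 * a * y)) y := by
    have : HasDerivAt (fun y : ℝ => -2 * a * y) (-2 * a) y := by
      simpa using (hasDerivAt_id y).const_mul (-2 * a)
    exact this.exp.congr_deriv (by ring)
  have hm₁ (y : ℝ) : HasDerivAt (fun y => y + a * σ ^ 2 * t) 1 y := (hasDerivAt_id y).add_const _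
  have hm₂ (y : ℝ) : HasDerivAt (fun y => a * σ ^ 2 * t - y) (-1) y :=
    (hasDerivAt_id y).const_sub _
  have hP₁ (y : ℝ) : HasDerivAt (fun y => posPartMean (y + a * σ ^ 2 * t) s)
      (stdCDF ((y + a * σ ^ 2 * t) / s)) y :=
    (hasDerivAt_posPartMean (hm₁ y) (hasDerivAt_const y s) (by simp [hs])).congr_deriv (by ring)
  have hP₂ (y : ℝ) : HasDerivAt (fun y => posPartMean (a * σ ^ 2 * t - y) s)
      (-stdCDF ((a * σ ^ 2 * t - y) / s)) y :=
    (hasDerivAt_posPartMean (hm₂ y) (hasDerivAt_const y s) (by simp [hs])).congr_deriv (by ring)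
  have hN₁ (y : ℝ) : HasDerivAt (fun y => stdCDF ((y + a * σ ^ 2 * t) / s))
      (stdPDF ((y + a * σ ^ 2 * t) / s) / s) y :=
    ((hasDerivAt_stdCDF _).comp y ((hm₁ y).div_const s)).congr_deriv (by ring)
  have hN₂ (y : ℝ) : HasDerivAt (fun y => stdCDF ((a * σ ^ 2 * t - y) / s))
      (-stdPDF ((a * σ ^ 2 * t - y) / s) / s) y :=
    ((hasDerivAt_stdCDF _).comp y ((hm₂ y).div_const s)).congr_deriv (by ring)
  have hd : deriv (fun y => absorbedMean a σ y t) = fun y => stdCDF ((y + a * σ ^ 2 * t) / s)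
      + 2 * a * (Real.exp (-2 * a * y) * posPartMean (a * σ ^ 2 * t - y) s)
      + Real.exp (-2 * a * y) * stdCDF ((a * σ ^ 2 * t - y) / s) := by
    ext y
    exact (((hP₁ y).sub ((hE y).mul (hP₂ y))).congr_deriv (by ring)).deriv
  have hdd : deriv (deriv (fun y => absorbedMean a σ y t)) x = stdPDF ((x + a * σ ^ 2 * t) / s) / s
      - 4 * a ^ 2 * (Real.exp (-2 * a * x) * posPartMean (a * σ ^ 2 * t - x) s)
      - 4 * a * (Real.exp (-2 * a * x) * stdCDF ((a * σ ^ 2 * t - x) / s))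
      - Real.exp (-2 * a * x) * stdPDF ((a * σ ^ 2 * t - x) / s) / s := by
    rw [hd]
    exact ((((hN₁ x).add (((hE x).mul (hP₂ x)).const_mul (2 * a))).add
      ((hE x).mul (hN₂ x))).congr_deriv (by ring)).deriv
  have hst : HasDerivAt (fun t => σ * Real.sqrt t) (σ ^ 2 / (2 * s)) t :=
    ((Real.hasDerivAt_sqrt ht.ne').const_mul σ).congr_deriv (by rw [hs_def]; field_simp)
  have hpos : ∀ᶠ t' in nhds t, 0 < σ * Real.sqrt t' := by
    filter_upwards [Ioi_mem_nhds ht] with t' h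
    exact mul_pos hσ (Real.sqrt_pos.2 h)
  have hlin : HasDerivAt (fun t : ℝ => a * σ ^ 2 * t) (a * σ ^ 2) t := by
    simpa using (hasDerivAt_id t).const_mul (a * σ ^ 2)
  have ht₁ := hasDerivAt_posPartMean (hlin.const_add x) hst hpos
  have ht₂ := hasDerivAt_posPartMean (hlin.sub_const x) hst hpos
  refine (ht₁.sub (ht₂.const_mul (Real.exp (-2 * a * x)))).congr_deriv ?_
  unfold gen
  rw [hdd, hd, ← hs_def]
  field_simp
  ring

lemma abs_absorbedMean_le {a σ x t T : ℝ} (ha : 0 ≤ a) (hσ : 0 < σ) (hx : 0 ≤ x) (ht : 0 ≤ t)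
    (htT : t ≤ T) : |absorbedMean a σ x t|
      ≤ (2 + 2 * (a * σ ^ 2 * T + σ * Real.sqrt T * stdAbsMean)) * (1 + x) := by
  have hm : 0 ≤ a * σ ^ 2 * t := by positivity
  have hmT : a * σ ^ 2 * t ≤ a * σ ^ 2 * T := mul_le_mul_of_nonneg_left htT (by positivity)
  have hsT : σ * Real.sqrt t * stdAbsMean ≤ σ * Real.sqrt T * stdAbsMean := by
    have := stdAbsMean_nonneg
    gcongr
  have hs : |σ * Real.sqrt t| = σ * Real.sqrt t := abs_of_nonneg (by positivity)
  have h1 := posPartMean_le (x + a * σ ^ 2 * t) (σ * Real.sqrt t)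
  have h2 := posPartMean_le (a * σ ^ 2 * t - x) (σ * Real.sqrt t)
  rw [hs] at h1 h2
  rw [abs_of_nonneg (by positivity : 0 ≤ x + a * σ ^ 2 * t)] at h1
  have h3 : |a * σ ^ 2 * t - x| ≤ a * σ ^ 2 * t + x := by
    rw [abs_le]; constructor <;> linarith
  have h4 : Real.exp (-2 * a * x) ≤ 1 := Real.exp_le_one_iff.2 (by nlinarith [mul_nonneg ha hx])
  have h5 := posPartMean_nonneg (x + a * σ ^ 2 * t) (σ * Real.sqrt t)
  have h6 := posPartMean_nonneg (a * σ ^ 2 * t - x) (σ * Real.sqrt t)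
  have h7 : Real.exp (-2 * a * x) * posPartMean (a * σ ^ 2 * t - x) (σ * Real.sqrt t)
      ≤ posPartMean (a * σ ^ 2 * t - x) (σ * Real.sqrt t) := mul_le_of_le_one_left h6 h4
  have h8 : 0 ≤ Real.exp (-2 * a * x) * posPartMean (a * σ ^ 2 * t - x) (σ * Real.sqrt t) :=
    mul_nonneg (Real.exp_pos _).le h6
  have h9 : 0 ≤ σ * Real.sqrt t * stdAbsMean := mul_nonneg (by positivity) stdAbsMean_nonneg
  set M := a * σ ^ 2 * T + σ * Real.sqrt T * stdAbsMean
  have hM : 0 ≤ M := by linarith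
  unfold absorbedMean
  rw [abs_le]
  constructor <;> nlinarith [mul_nonneg hM hx]

lemma isDirichletSolution_absorbedMean {a σ : ℝ} (ha : 0 ≤ a) (hσ : 0 < σ) :
    IsDirichletSolution (a * σ ^ 2) σ (absorbedMean a σ) where
  continuousOn := (continuous_absorbedMean a σ).continuousOn
  contDiffAt x t _ ht := (contDiff_absorbedMean a hσ ht).contDiffAt
  hasDerivAt x t _ ht := gen_absorbedMean a hσ ht x
  boundary t _ := by simp [absorbedMean]
  initial x hx := by
    simp [absorbedMean, posPartMean_zero_right, hx.le]
  growth T := ⟨_, fun _ _ hx ht htT => abs_absorbedMean_le ha hσ hx ht htT⟩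

lemma IsDirichletSolution.eq_absorbedMean {a σ : ℝ} (ha : 0 ≤ a) (hσ : 0 < σ) {h : ℝ → ℝ → ℝ}
    (hh : IsDirichletSolution (a * σ ^ 2) σ h) {x t : ℝ} (hx : 0 ≤ x) (ht : 0 ≤ t) :
    h x t = absorbedMean a σ x t :=
  le_antisymm (hh.le (by positivity) (isDirichletSolution_absorbedMean ha hσ) hx ht)
    ((isDirichletSolution_absorbedMean ha hσ).le (by positivity) hh hx ht)

/-! ### Laplace transforms of rapidly decaying data -/

/-- Functions on the half-line that decay faster than every exponential. -/
structure RapidDecay (q : ℝ → ℝ) : Prop where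
  measurable : Measurable q
  integrableOn : ∀ l : ℝ, IntegrableOn (fun y => Real.exp (l * y) * q y) (Ioi 0)

/-- The two-sided Laplace transform of a function supported on the positive half-line. -/
def laplace (q : ℝ → ℝ) (x : ℝ) : ℝ := ∫ y in Ioi (0 : ℝ), Real.exp (x * y) * q y

lemma RapidDecay.add {q r : ℝ → ℝ} (hq : RapidDecay q) (hr : RapidDecay r) :
    RapidDecay fun y => q y + r y :=
  ⟨hq.measurable.add hr.measurable, fun l =>
    ((hq.integrableOn l).add (hr.integrableOn l)).congr (ae_of_all _ fun y => by
      simp only [Pi.add_apply]; ring)⟩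

lemma RapidDecay.const_mul {q : ℝ → ℝ} (hq : RapidDecay q) (k : ℝ) :
    RapidDecay fun y => k * q y :=
  ⟨hq.measurable.const_mul k, fun l =>
    ((hq.integrableOn l).const_mul k).congr (ae_of_all _ fun y => by ring)⟩

lemma RapidDecay.sub {q r : ℝ → ℝ} (hq : RapidDecay q) (hr : RapidDecay r) :
    RapidDecay fun y => q y - r y := by
  simpa [sub_eq_add_neg] using hq.add (hr.const_mul (-1))

lemma RapidDecay.exp_mul {q : ℝ → ℝ} (hq : RapidDecay q) (k : ℝ) :
    RapidDecay fun y => Real.exp (k * y) * q y :=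
  ⟨Measurable.mul (by fun_prop) hq.measurable, fun l =>
    (hq.integrableOn (l + k)).congr (ae_of_all _ fun y => by
      simp only [add_mul, Real.exp_add]; ring)⟩

lemma RapidDecay.id_mul {q : ℝ → ℝ} (hq : RapidDecay q) : RapidDecay fun y => y * q y := by
  refine ⟨measurable_id.mul hq.measurable, fun l => ?_⟩
  refine Integrable.mono (hq.integrableOn (l + 1))
    (((measurable_id.const_mul l).exp.mul (measurable_id.mul hq.measurable)).aestronglyMeasurable) ?_
  filter_upwards [ae_restrict_mem measurableSet_Ioi] with y hy
  rw [mem_Ioi] at hy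
  have h : y ≤ Real.exp y := by linarith [Real.add_one_le_exp y]
  rw [norm_mul, norm_mul, norm_mul, Real.norm_of_nonneg (Real.exp_pos _).le,
    Real.norm_of_nonneg (Real.exp_pos _).le, Real.norm_of_nonneg hy.le, add_mul, one_mul,
    Real.exp_add, mul_assoc]
  gcongr

/-- Differentiation under the integral sign; as y > 0, the integrand at x + 1 dominates uniformly on
the unit ball around x. -/
lemma hasDerivAt_laplace {q : ℝ → ℝ} (hq : RapidDecay q) (x : ℝ) :
    HasDerivAt (laplace q) (laplace (fun y => y * q y) x) x := by
  have h := hasDerivAt_integral_of_dominated_loc_of_deriv_le (μ := volume.restrict (Ioi (0 : ℝ)))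
    (F := fun x y => Real.exp (x * y) * q y) (F' := fun x y => Real.exp (x * y) * (y * q y))
    (x₀ := x) (s := Metric.ball x 1) (bound := fun y => ‖Real.exp ((x + 1) * y) * (y * q y)‖)
    (Metric.ball_mem_nhds x one_pos)
    (Filter.Eventually.of_forall fun x' => (hq.integrableOn x').aestronglyMeasurable)
    (hq.integrableOn x) (hq.id_mul.integrableOn x).aestronglyMeasurable ?_
    (hq.id_mul.integrableOn (x + 1)).norm ?_
  · exact h.2
  · filter_upwards [ae_restrict_mem measurableSet_Ioi] with y hy x' hx'
    rw [mem_Ioi] at hy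
    rw [norm_mul, norm_mul (Real.exp _), Real.norm_of_nonneg (Real.exp_pos _).le,
      Real.norm_of_nonneg (Real.exp_pos _).le]
    have : x' ≤ x + 1 := by
      rw [Metric.mem_ball, Real.dist_eq] at hx'
      linarith [(abs_lt.1 hx').2]
    gcongr
  · refine ae_of_all _ fun y x' _ => ?_
    have : HasDerivAt (fun x : ℝ => x * y) y x' := by simpa using (hasDerivAt_id x').mul_const y
    exact (this.exp.mul_const (q y)).congr_deriv (by ring)

lemma contDiff_laplace {q : ℝ → ℝ} (hq : RapidDecay q) (n : ℕ) : ContDiff ℝ n (laplace q) := by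
  induction n generalizing q with
  | zero =>
    exact contDiff_zero.2 (continuous_iff_continuousAt.2 fun x =>
      (hasDerivAt_laplace hq x).continuousAt)
  | succ n ih =>
    have hd : deriv (laplace q) = laplace fun y => y * q y :=
      funext fun x => (hasDerivAt_laplace hq x).deriv
    push_cast
    rw [contDiff_succ_iff_deriv]
    exact ⟨fun x => (hasDerivAt_laplace hq x).differentiableAt, by simp, hd ▸ ih hq.id_mul⟩

/-! ### Hyperbolic inequalities and the monotone ratio I₂/I₁ -/

lemma hasDerivAt_sinh_aux (v : ℝ) : HasDerivAt
    (fun v => v * Real.cosh v - Real.sinh v) (v * Real.sinh v) v :=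
  (((hasDerivAt_id v).mul (Real.hasDerivAt_cosh v)).sub (Real.hasDerivAt_sinh v)).congr_deriv
    (by simp)

lemma mul_cosh_sub_sinh_pos {v : ℝ} (hv : 0 < v) : 0 < v * Real.cosh v - Real.sinh v := by
  have h : StrictMonoOn (fun v => v * Real.cosh v - Real.sinh v) (Ici 0) := by
    refine strictMonoOn_of_deriv_pos (convex_Ici 0) (by fun_prop) fun y hy => ?_
    rw [interior_Ici, mem_Ioi] at hy
    rw [(hasDerivAt_sinh_aux y).deriv]
    exact mul_pos hy (Real.sinh_pos_iff.2 hy)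
  simpa using h self_mem_Ici hv.le hv

lemma hasDerivAt_sinh_aux₂ (v : ℝ) : HasDerivAt
    (fun v => v ^ 2 * Real.sinh v - 3 * (v * Real.cosh v - Real.sinh v))
    (v * (v * Real.cosh v - Real.sinh v)) v :=
  (((hasDerivAt_pow 2 v).mul (Real.hasDerivAt_sinh v)).sub
    ((hasDerivAt_sinh_aux v).const_mul 3)).congr_deriv (by norm_num; ring)

lemma sq_mul_sinh_sub_nonneg {v : ℝ} (hv : 0 ≤ v) :
    0 ≤ v ^ 2 * Real.sinh v - 3 * (v * Real.cosh v - Real.sinh v) := by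
  have h : MonotoneOn (fun v => v ^ 2 * Real.sinh v - 3 * (v * Real.cosh v - Real.sinh v))
      (Ici 0) := by
    refine monotoneOn_of_deriv_nonneg (convex_Ici 0) (by fun_prop) (by fun_prop) fun y hy => ?_
    rw [interior_Ici, mem_Ioi] at hy
    rw [(hasDerivAt_sinh_aux₂ y).deriv]
    exact (mul_pos hy (mul_cosh_sub_sinh_pos hy)).le
  simpa using h self_mem_Ici hv hv

/-- The difference of the two sides and its first derivative vanish at 0, and the second derivative
is 4 sinh v (v cosh v - sinh v) ≥ 0. -/
lemma two_mul_sinh_sq_le {v : ℝ} (hv : 0 ≤ v) :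
    2 * Real.sinh v ^ 2 ≤ v ^ 2 + v * Real.cosh v * Real.sinh v := by
  have hd₁ (v : ℝ) : HasDerivAt
      (fun v => 3 * v + 2 * v * Real.sinh v ^ 2 - 3 * (Real.sinh v * Real.cosh v))
      (4 * Real.sinh v * (v * Real.cosh v - Real.sinh v)) v := by
    have h1 : HasDerivAt (fun v : ℝ => 2 * v) 2 v := by
      simpa using (hasDerivAt_id v).const_mul 2
    have h2 : HasDerivAt (fun v : ℝ => 3 * v) 3 v := by
      simpa using (hasDerivAt_id v).const_mul 3
    refine ((h2.add (h1.mul ((Real.hasDerivAt_sinh v).pow 2))).sub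
      (((Real.hasDerivAt_sinh v).mul (Real.hasDerivAt_cosh v)).const_mul 3)).congr_deriv ?_
    have := Real.cosh_sq v
    simp only [Pi.pow_apply]
    norm_num
    linear_combination (-3) * this
  have hd₂ (v : ℝ) : HasDerivAt
      (fun v => v ^ 2 + v * Real.cosh v * Real.sinh v - 2 * Real.sinh v ^ 2)
      (3 * v + 2 * v * Real.sinh v ^ 2 - 3 * (Real.sinh v * Real.cosh v)) v := by
    refine (((hasDerivAt_pow 2 v).add (((hasDerivAt_id v).mul (Real.hasDerivAt_cosh v)).mul
      (Real.hasDerivAt_sinh v))).sub (((Real.hasDerivAt_sinh v).pow 2).const_mul 2)).congr_deriv ?_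
    have := Real.cosh_sq v
    simp only [Pi.mul_apply, id_eq]
    norm_num
    linear_combination v * this
  have h₁ {v : ℝ} (hv : 0 ≤ v) :
      0 ≤ 3 * v + 2 * v * Real.sinh v ^ 2 - 3 * (Real.sinh v * Real.cosh v) := by
    have h : MonotoneOn (fun v => 3 * v + 2 * v * Real.sinh v ^ 2
        - 3 * (Real.sinh v * Real.cosh v)) (Ici 0) := by
      refine monotoneOn_of_deriv_nonneg (convex_Ici 0) (by fun_prop) (by fun_prop) fun y hy => ?_
      rw [interior_Ici, mem_Ioi] at hy
      rw [(hd₁ y).deriv]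
      have := mul_cosh_sub_sinh_pos hy
      have := Real.sinh_pos_iff.2 hy
      positivity
    simpa using h self_mem_Ici hv hv
  have h : MonotoneOn (fun v => v ^ 2 + v * Real.cosh v * Real.sinh v - 2 * Real.sinh v ^ 2)
      (Ici 0) := by
    refine monotoneOn_of_deriv_nonneg (convex_Ici 0) (by fun_prop) (by fun_prop) fun y hy => ?_
    rw [interior_Ici, mem_Ioi] at hy
    rw [(hd₂ y).deriv]
    exact h₁ hy.le
  have := h self_mem_Ici hv hv
  simp only [Real.sinh_zero] at this
  linarith

/-- Up to powers of v the numerator and denominator are modified spherical Bessel functions of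
orders 2 and 1. By cosh² - sinh² = 1 the numerator of the derivative is v times the quantity bounded
in `two_mul_sinh_sq_le`. -/
lemma monotoneOn_sinh_ratio : MonotoneOn (fun v =>
    (v ^ 2 * Real.sinh v - 3 * (v * Real.cosh v - Real.sinh v))
      / (v * Real.cosh v - Real.sinh v)) (Ioi 0) := by
  have hd {v : ℝ} (hv : 0 < v) :=
    (hasDerivAt_sinh_aux₂ v).div (hasDerivAt_sinh_aux v) (mul_cosh_sub_sinh_pos hv).ne'
  refine monotoneOn_of_deriv_nonneg (convex_Ioi 0)
    (fun v hv => (hd hv).continuousAt.continuousWithinAt) ?_ fun v hv => ?_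
  · rw [interior_Ioi]
    exact fun v hv => (hd hv).differentiableAt.differentiableWithinAt
  · rw [interior_Ioi] at hv
    have h := (hd hv).deriv
    rw [show (fun v => (v ^ 2 * Real.sinh v - 3 * (v * Real.cosh v - Real.sinh v))
      / (v * Real.cosh v - Real.sinh v)) = (fun v => v ^ 2 * Real.sinh v
        - 3 * (v * Real.cosh v - Real.sinh v)) / fun v => v * Real.cosh v - Real.sinh v from rfl, h]
    refine div_nonneg ?_ (sq_nonneg _)
    have h1 := two_mul_sinh_sq_le (le_of_lt hv)
    have h2 := Real.cosh_sq v
    rw [show v * (v * Real.cosh v - Real.sinh v) * (v * Real.cosh v - Real.sinh v)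
        - (v ^ 2 * Real.sinh v - 3 * (v * Real.cosh v - Real.sinh v)) * (v * Real.sinh v)
        = v * (v ^ 2 + v * Real.cosh v * Real.sinh v - 2 * Real.sinh v ^ 2) by
      linear_combination v ^ 3 * h2]
    exact mul_nonneg (le_of_lt hv) (by linarith)

/-- If `q` changes sign once from `-` to `+`, then so does `i₂ q - κ i₁ q` for a suitable `κ`. -/
lemma exists_nonneg_sinh_combination {q : ℝ → ℝ} {y₀ θ : ℝ} (hθ : 0 < θ) (hy₀ : 0 ≤ y₀)
    (hneg : ∀ y, 0 < y → y < y₀ → q y ≤ 0) (hpos : ∀ y, y₀ ≤ y → 0 ≤ q y) :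
    ∃ κ : ℝ, 0 ≤ κ ∧ ∀ y, 0 < y → 0 ≤
      (((θ * y) ^ 2 * Real.sinh (θ * y) - 3 * (θ * y * Real.cosh (θ * y) - Real.sinh (θ * y)))
        - κ * (θ * y * Real.cosh (θ * y) - Real.sinh (θ * y))) * q y := by
  rcases hy₀.eq_or_lt with rfl | hy₀
  · refine ⟨0, le_rfl, fun y hy => ?_⟩
    rw [zero_mul, sub_zero]
    exact mul_nonneg (sq_mul_sinh_sub_nonneg (by positivity)) (hpos y hy.le)
  · have hv₀ : 0 < θ * y₀ := by positivity
    -- κ is the ratio at θy₀, so that I₂ - κI₁ changes sign exactly where q may.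
    refine ⟨_, div_nonneg (sq_mul_sinh_sub_nonneg hv₀.le) (mul_cosh_sub_sinh_pos hv₀).le,
      fun y hy => ?_⟩
    have hv : 0 < θ * y := by positivity
    rcases lt_or_ge y y₀ with h | h
    · have h1 := monotoneOn_sinh_ratio hv hv₀ (mul_le_mul_of_nonneg_left h.le hθ.le)
      simp only at h1
      rw [div_le_iff₀ (mul_cosh_sub_sinh_pos hv)] at h1
      exact mul_nonneg_of_nonpos_of_nonpos (by linarith) (hneg y hy h)
    · have h1 := monotoneOn_sinh_ratio hv₀ hv (mul_le_mul_of_nonneg_left h hθ.le)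
      simp only at h1
      rw [le_div_iff₀ (mul_cosh_sub_sinh_pos hv)] at h1
      exact mul_nonneg (by linarith) (hpos y h)

lemma integral_linear_combination_three {α : Type*} [MeasurableSpace α] {ν : Measure α}
    {f g h : α → ℝ} (hf : Integrable f ν) (hg : Integrable g ν) (hh : Integrable h ν)
    (r s t : ℝ) : Integrable (fun y => r * f y + s * g y + t * h y) ν ∧
      ∫ y, (r * f y + s * g y + t * h y) ∂ν
        = r * ∫ y, f y ∂ν + s * ∫ y, g y ∂ν + t * ∫ y, h y ∂ν := by
  have hfg : Integrable (fun y => r * f y + s * g y) ν := (hf.const_mul r).add (hg.const_mul s)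
  refine ⟨hfg.add (hh.const_mul t), ?_⟩
  rw [integral_add hfg (hh.const_mul t), integral_add (hf.const_mul r) (hg.const_mul s),
    integral_const_mul, integral_const_mul, integral_const_mul]

/-! ### Nondegeneracy of double zeros -/

/-- The transform of data `q` on the positive half-line and `n - q` on the negative one. -/
def twoSided (q n : ℝ → ℝ) (θ : ℝ) : ℝ := laplace q θ + laplace (fun y => n y - q y) (-θ)

lemma hasDerivAt_twoSided {q n : ℝ → ℝ} (hq : RapidDecay q) (hn : RapidDecay n) (θ : ℝ) :
    HasDerivAt (twoSided q n) (laplace (fun y => y * q y) θ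
      - laplace (fun y => y * (n y - q y)) (-θ)) θ :=
  ((hasDerivAt_laplace hq θ).add
    ((hasDerivAt_laplace (hn.sub hq) (-θ)).comp θ (hasDerivAt_neg θ))).congr_deriv (by ring)

lemma hasDerivAt_deriv_twoSided {q n : ℝ → ℝ} (hq : RapidDecay q) (hn : RapidDecay n) (θ : ℝ) :
    HasDerivAt (deriv (twoSided q n)) (laplace (fun y => y * (y * q y)) θ
      + laplace (fun y => y * (y * (n y - q y))) (-θ)) θ := by
  rw [funext fun θ => (hasDerivAt_twoSided hq hn θ).deriv]
  exact ((hasDerivAt_laplace hq.id_mul θ).sub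
    ((hasDerivAt_laplace (hn.sub hq).id_mul (-θ)).comp θ (hasDerivAt_neg θ))).congr_deriv (by ring)

/-- A double zero of `twoSided q n` is nondegenerate if `q` changes sign once from `-` to `+` and
`n` is positive. -/
lemma deriv_deriv_twoSided_pos {q n : ℝ → ℝ} (hq : RapidDecay q) (hn : RapidDecay n) {θ y₀ : ℝ}
    (hθ : 0 < θ) (hy₀ : 0 ≤ y₀) (hneg : ∀ y, 0 < y → y < y₀ → q y ≤ 0)
    (hpos : ∀ y, y₀ ≤ y → 0 ≤ q y) (hn0 : ∀ y, 0 < y → 0 < n y)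
    (h0 : twoSided q n θ = 0) (h1 : deriv (twoSided q n) θ = 0) :
    0 < deriv (deriv (twoSided q n)) θ := by
  obtain ⟨κ, hκ, hκq⟩ := exists_nonneg_sinh_combination hθ hy₀ hneg hpos
  set T₂ := deriv (deriv (twoSided q n)) θ with hT₂
  have e2 := (hasDerivAt_deriv_twoSided hq hn θ).deriv
  have e1 := (hasDerivAt_twoSided hq hn θ).deriv
  rw [← hT₂] at e2
  rw [h1] at e1
  have e0 : 0 = laplace q θ + laplace (fun y => n y - q y) (-θ) := h0.symm
  -- A and B are the two integrands of θ²T'' - (3+κ)θT' + (3+κ)T. The coefficients make the q-part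
  -- collapse to the hyperbolic combination of `exists_nonneg_sinh_combination`, leaving a positive
  -- multiple of n.
  let A : ℝ → ℝ := fun y => θ ^ 2 * (Real.exp (θ * y) * (y * (y * q y)))
    + (-((3 + κ) * θ)) * (Real.exp (θ * y) * (y * q y)) + (3 + κ) * (Real.exp (θ * y) * q y)
  let B : ℝ → ℝ := fun y => θ ^ 2 * (Real.exp (-θ * y) * (y * (y * (n y - q y))))
    + ((3 + κ) * θ) * (Real.exp (-θ * y) * (y * (n y - q y)))
    + (3 + κ) * (Real.exp (-θ * y) * (n y - q y))
  have hr := hn.sub hq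
  obtain ⟨iA, sA⟩ := integral_linear_combination_three (hq.id_mul.id_mul.integrableOn θ)
    (hq.id_mul.integrableOn θ) (hq.integrableOn θ) (θ ^ 2) (-((3 + κ) * θ)) (3 + κ)
  obtain ⟨iB, sB⟩ := integral_linear_combination_three (hr.id_mul.id_mul.integrableOn (-θ))
    (hr.id_mul.integrableOn (-θ)) (hr.integrableOn (-θ)) (θ ^ 2) ((3 + κ) * θ) (3 + κ)
  have hsum : ∫ y in Ioi 0, (A y + B y) = θ ^ 2 * T₂ := by
    rw [integral_add iA iB, sA, sB, e2]
    simp only [laplace] at e0 e1 ⊢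
    linear_combination (-(3 + κ) * θ) * e1 * (-1) + (3 + κ) * e0 * (-1)
  have hAB (y : ℝ) (hy : 0 < y) : 0 < A y + B y := by
    have h := hκq y hy
    have hv : 0 < θ * y := by positivity
    have hid : A y + B y = 2 * ((((θ * y) ^ 2 * Real.sinh (θ * y)
        - 3 * (θ * y * Real.cosh (θ * y) - Real.sinh (θ * y)))
        - κ * (θ * y * Real.cosh (θ * y) - Real.sinh (θ * y))) * q y)
        + ((θ * y) ^ 2 + (3 + κ) * (θ * y) + (3 + κ)) * Real.exp (-(θ * y)) * n y := by
      simp only [A, B, Real.sinh_eq, Real.cosh_eq, neg_mul]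
      ring
    rw [hid]
    have := hn0 y hy
    have : 0 < ((θ * y) ^ 2 + (3 + κ) * (θ * y) + (3 + κ)) * Real.exp (-(θ * y)) * n y := by
      positivity
    linarith
  have hint : 0 < ∫ y in Ioi 0, (A y + B y) := by
    rw [setIntegral_pos_iff_support_of_nonneg_ae
      ((ae_restrict_mem measurableSet_Ioi).mono fun y hy => (hAB y hy).le) (iA.add iB)]
    have : Function.support (fun y => A y + B y) ∩ Ioi 0 = Ioi 0 :=
      inter_eq_right.2 fun y hy => (hAB y hy).ne'
    rw [this]
    simp
  rw [hsum] at hint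
  exact pos_of_mul_pos_right hint (sq_nonneg θ)

/-! ### Gaussian kernels as exponential kernels in x/τ -/

/-- The part of the Gaussian transition density that depends on the end point only. -/
def kernelWeight (a : ℝ) (τ : ℝ≥0) (y : ℝ) : ℝ := Real.exp (a * y - y ^ 2 / (2 * τ))

/-- The part of the Gaussian transition density that depends on the starting point only. -/
def kernelScale (a : ℝ) (τ : ℝ≥0) (x : ℝ) : ℝ :=
  (Real.sqrt (2 * Real.pi * τ))⁻¹ * Real.exp (-(a * x) - a ^ 2 * τ / 2 - x ^ 2 / (2 * τ))

lemma kernelScale_pos (a x : ℝ) {τ : ℝ≥0} (hτ : τ ≠ 0) : 0 < kernelScale a τ x := by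
  have : (0 : ℝ) < τ := by positivity
  unfold kernelScale
  positivity

lemma contDiff_kernelScale {n : WithTop ℕ∞} (a : ℝ) (τ : ℝ≥0) : ContDiff ℝ n (kernelScale a τ) := by
  unfold kernelScale
  fun_prop

lemma gaussianPDFReal_add_drift (a x y : ℝ) {τ : ℝ≥0} (hτ : τ ≠ 0) :
    gaussianPDFReal (x + a * τ) τ y
      = kernelScale a τ x * (Real.exp (x / τ * y) * kernelWeight a τ y) := by
  have : (τ : ℝ) ≠ 0 := by exact_mod_cast hτ
  simp only [gaussianPDFReal, kernelScale, kernelWeight]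
  rw [mul_assoc (Real.sqrt _)⁻¹, ← Real.exp_add, ← Real.exp_add]
  congr 2
  field_simp
  ring

lemma gaussianPDFReal_reflected (a x y : ℝ) {τ : ℝ≥0} (hτ : τ ≠ 0) :
    Real.exp (-2 * a * x) * gaussianPDFReal (a * τ - x) τ y
      = kernelScale a τ x * (Real.exp (-(x / τ) * y) * kernelWeight a τ y) := by
  have : (τ : ℝ) ≠ 0 := by exact_mod_cast hτ
  simp only [gaussianPDFReal, kernelScale, kernelWeight]
  rw [mul_left_comm, mul_assoc (Real.sqrt _)⁻¹, ← Real.exp_add, ← Real.exp_add, ← Real.exp_add]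
  congr 2
  field_simp
  ring

lemma rapidDecay_kernelWeight (a : ℝ) {τ : ℝ≥0} (hτ : τ ≠ 0) : RapidDecay (kernelWeight a τ) := by
  have hτ' : (τ : ℝ) ≠ 0 := by exact_mod_cast hτ
  refine ⟨by unfold kernelWeight; fun_prop, fun l => ?_⟩
  have h := (integrable_gaussianPDFReal (l * τ + a * τ) τ).const_mul (kernelScale a τ (l * τ))⁻¹
  refine h.integrableOn.congr (ae_of_all _ fun y => ?_)
  simp only
  rw [gaussianPDFReal_add_drift _ _ _ hτ, ← mul_assoc,
    inv_mul_cancel₀ (kernelScale_pos _ _ hτ).ne', one_mul, mul_div_cancel_right₀ _ hτ']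

/-- The transition operator of Brownian motion with drift `a`, killed at `0`. -/
def killedTransform (a : ℝ) (τ : ℝ≥0) (f : ℝ → ℝ) (x : ℝ) : ℝ :=
  kernelScale a τ x * (laplace f (x / τ) - laplace f (-(x / τ)))

/-- The direct and the image density share the factor `kernelScale` and the weight in y; they differ
only in the sign of the exponent xy/τ. -/
lemma integral_sub_reflected (a x : ℝ) {τ : ℝ≥0} (hτ : τ ≠ 0) (f : ℝ → ℝ) :
    (∫ y in Ioi 0, gaussianPDFReal (x + a * τ) τ y * f y)
      - Real.exp (-2 * a * x) * ∫ y in Ioi 0, gaussianPDFReal (a * τ - x) τ y * f y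
      = killedTransform a τ (fun y => f y * kernelWeight a τ y) x := by
  rw [killedTransform, mul_sub, laplace, laplace, ← integral_const_mul, ← integral_const_mul,
    ← integral_const_mul]
  congr 1 <;> refine integral_congr_ae (ae_of_all _ fun y => ?_)
  · simp only [gaussianPDFReal_add_drift a x y hτ]; ring
  · have := gaussianPDFReal_reflected a x y hτ
    simp only
    linear_combination f y * this

lemma surv_eq_killedTransform (a x : ℝ) {τ : ℝ≥0} (hτ : τ ≠ 0) :
    surv a τ x = killedTransform a τ (kernelWeight a τ) x := by
  have h := integral_sub_reflected a x hτ fun _ => 1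
  simp only [mul_one, one_mul] at h
  rw [← h, surv]
  have hp (m : ℝ) : posMass m τ = ∫ y in Ioi 0, gaussianPDFReal m τ y := by
    rw [posMass, measureReal_def, gaussianReal_apply_eq_integral _ hτ,
      ENNReal.toReal_ofReal (integral_nonneg fun _ => gaussianPDFReal_nonneg _ _ _)]
  rw [hp, hp]

lemma posPartMean_eq_setIntegral (m : ℝ) {τ : ℝ≥0} (hτ : τ ≠ 0) :
    posPartMean m (Real.sqrt τ) = ∫ y in Ioi 0, gaussianPDFReal m τ y * y := by
  rw [posPartMean_sqrt, integral_gaussianReal_eq_integral_smul hτ,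
    ← integral_indicator measurableSet_Ioi]
  refine integral_congr_ae (ae_of_all _ fun y => ?_)
  by_cases hy : 0 < y
  · simp [indicator, hy, hy.le]
  · simp [indicator, hy, not_lt.1 hy]

lemma absorbedMean_eq_killedTransform (a x : ℝ) {σ t : ℝ} (hσ : 0 ≤ σ) {τ : ℝ≥0}
    (hτ0 : τ ≠ 0) (hτ : (τ : ℝ) = σ ^ 2 * t) : absorbedMean a σ x t
      = killedTransform a τ (fun y => y * kernelWeight a τ y) x := by
  have hs : σ * Real.sqrt t = Real.sqrt τ := by
    rw [hτ, Real.sqrt_mul (sq_nonneg σ), Real.sqrt_sq hσ]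
  rw [absorbedMean, ← integral_sub_reflected a x hτ0 fun y => y, hs, mul_assoc, ← hτ,
    posPartMean_eq_setIntegral _ hτ0, posPartMean_eq_setIntegral _ hτ0]

lemma kernelWeight_neg (a y : ℝ) (τ : ℝ≥0) : kernelWeight a τ (-y) = kernelWeight (-a) τ y := by
  simp [kernelWeight]

/-- The Gaussian moment generating function, split at 0. Folding the negative half onto the positive
one changes the sign of x/τ and of the drift in the weight. -/
lemma exp_eq_laplace (a r x : ℝ) {τ : ℝ≥0} (hτ : τ ≠ 0) :
    Real.exp ((r * a + r ^ 2 / 2) * τ) * Real.exp (r * x) = kernelScale a τ x *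
      (laplace (fun y => Real.exp (r * y) * kernelWeight a τ y) (x / τ)
        + laplace (fun y => Real.exp (-r * y) * kernelWeight (-a) τ y) (-(x / τ))) := by
  have h := integral_exp_mul_gaussianReal r (x + a * τ) τ fun _ => 1
  simp only [mul_one, integral_const, probReal_univ, smul_eq_mul] at h
  rw [← Real.exp_add, show (r * a + r ^ 2 / 2) * τ + r * x
    = r * (x + a * τ) + r ^ 2 * τ / 2 by ring, ← h, integral_gaussianReal_eq_integral_smul hτ]
  have hi : Integrable fun y => gaussianPDFReal (x + a * τ) τ y • Real.exp (r * y) := by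
    refine ((integrable_gaussianPDFReal (x + a * τ + r * τ) τ).const_mul
      (Real.exp (r * (x + a * τ) + r ^ 2 * τ / 2))).congr (ae_of_all _ fun y => ?_)
    have := exp_mul_gaussianPDFReal r (x + a * τ) y hτ
    simp only [smul_eq_mul]
    linarith
  have hneg := integral_comp_neg_Ioi 0 fun y =>
    gaussianPDFReal (x + a * τ) τ y • Real.exp (r * y)
  rw [neg_zero] at hneg
  rw [← integral_add_compl (measurableSet_Ioi (a := (0 : ℝ))) hi, compl_Ioi,
    ← hneg, mul_add, laplace, laplace, ← integral_const_mul,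
    ← integral_const_mul]
  congr 1 <;> refine integral_congr_ae (ae_of_all _ fun y => ?_)
  · simp only [gaussianPDFReal_add_drift a x y hτ, smul_eq_mul]; ring
  · simp only [gaussianPDFReal_add_drift a x (-y) hτ, smul_eq_mul, kernelWeight_neg, mul_neg,
      neg_mul]
    ring

lemma laplace_const_mul (q : ℝ → ℝ) (k θ : ℝ) : laplace (fun y => k * q y) θ = k * laplace q θ := by
  rw [laplace, laplace, ← integral_const_mul]
  exact integral_congr_ae (ae_of_all _ fun y => by ring)

lemma laplace_sub {q r : ℝ → ℝ} (hq : RapidDecay q) (hr : RapidDecay r) (θ : ℝ) :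
    laplace (fun y => q y - r y) θ = laplace q θ - laplace r θ := by
  rw [laplace, laplace, laplace, ← integral_sub (hq.integrableOn θ) (hr.integrableOn θ)]
  exact integral_congr_ae (ae_of_all _ fun y => by ring)

lemma laplace_add {q r : ℝ → ℝ} (hq : RapidDecay q) (hr : RapidDecay r) (θ : ℝ) :
    laplace (fun y => q y + r y) θ = laplace q θ + laplace r θ := by
  rw [laplace, laplace, laplace, ← integral_add (hq.integrableOn θ) (hr.integrableOn θ)]
  exact integral_congr_ae (ae_of_all _ fun y => by ring)

/-! ### Stationary solutions and the gap -/

/-- The solutions of the stationary equation. -/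
def stationary (a b A B : ℝ) (y : ℝ) : ℝ :=
  A * Real.exp ((b - a) * y) - B * Real.exp (-(b + a) * y)

lemma rapidDecay_stationary_mul (a b A B a' : ℝ) {τ : ℝ≥0} (hτ : τ ≠ 0) :
    RapidDecay fun y => stationary a b A B y * kernelWeight a' τ y := by
  have h := (((rapidDecay_kernelWeight a' hτ).exp_mul (b - a)).const_mul A).sub
    (((rapidDecay_kernelWeight a' hτ).exp_mul (-(b + a))).const_mul B)
  convert h using 2 with y
  unfold stationary
  ring

lemma rapidDecay_stationary_neg_mul (a b A B a' : ℝ) {τ : ℝ≥0} (hτ : τ ≠ 0) :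
    RapidDecay fun y => stationary a b A B (-y) * kernelWeight a' τ y := by
  have h := (((rapidDecay_kernelWeight a' hτ).exp_mul (-(b - a))).const_mul A).sub
    (((rapidDecay_kernelWeight a' hτ).exp_mul (b + a)).const_mul B)
  convert h using 2 with y
  unfold stationary
  ring_nf

lemma exp_mul_stationary (a b A B x : ℝ) {τ : ℝ≥0} (hτ : τ ≠ 0) :
    Real.exp ((b ^ 2 - a ^ 2) / 2 * τ) * stationary a b A B x = kernelScale a τ x *
      (laplace (fun y => stationary a b A B y * kernelWeight a τ y) (x / τ)
        + laplace (fun y => stationary a b A B (-y) * kernelWeight (-a) τ y) (-(x / τ))) := by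
  have hw := rapidDecay_kernelWeight a hτ
  have hw' := rapidDecay_kernelWeight (-a) hτ
  have e1 : (fun y => stationary a b A B y * kernelWeight a τ y)
      = fun y => A * (Real.exp ((b - a) * y) * kernelWeight a τ y)
        - B * (Real.exp (-(b + a) * y) * kernelWeight a τ y) := by
    ext y; unfold stationary; ring
  have e2 : (fun y => stationary a b A B (-y) * kernelWeight (-a) τ y)
      = fun y => A * (Real.exp (-(b - a) * y) * kernelWeight (-a) τ y)
        - B * (Real.exp (-(-(b + a)) * y) * kernelWeight (-a) τ y) := by
    ext y; unfold stationary; ring_nf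
  rw [e1, e2, laplace_sub ((hw.exp_mul _).const_mul _) ((hw.exp_mul _).const_mul _),
    laplace_sub ((hw'.exp_mul _).const_mul _) ((hw'.exp_mul _).const_mul _),
    laplace_const_mul, laplace_const_mul, laplace_const_mul, laplace_const_mul]
  have h1 := exp_eq_laplace a (b - a) x hτ
  have h2 := exp_eq_laplace a (-(b + a)) x hτ
  rw [show (b - a) * a + (b - a) ^ 2 / 2 = (b ^ 2 - a ^ 2) / 2 by ring] at h1
  rw [show -(b + a) * a + (-(b + a)) ^ 2 / 2 = (b ^ 2 - a ^ 2) / 2 by ring] at h2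
  unfold stationary
  linear_combination A * h1 - B * h2

/-- This sum is the datum n of the two-sided transform. Its sign is that of A - B, the value of the
stationary solution at 0; it vanishes for A = B, when the weighted solution is odd. -/
lemma stationary_symmetrized (a b A B y : ℝ) (τ : ℝ≥0) :
    stationary a b A B y * kernelWeight a τ y + stationary a b A B (-y) * kernelWeight (-a) τ y
      = (A - B) * (2 * Real.cosh (b * y) * Real.exp (-(y ^ 2 / (2 * τ)))) := by
  have h1 : kernelWeight a τ y = Real.exp (a * y) * Real.exp (-(y ^ 2 / (2 * τ))) := by
    rw [kernelWeight, sub_eq_add_neg, Real.exp_add]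
  have h2 : kernelWeight (-a) τ y = Real.exp (-(a * y)) * Real.exp (-(y ^ 2 / (2 * τ))) := by
    rw [kernelWeight, sub_eq_add_neg, Real.exp_add, neg_mul]
  have e1 : Real.exp ((b - a) * y) = Real.exp (b * y) * Real.exp (-(a * y)) := by
    rw [← Real.exp_add]; ring_nf
  have e2 : Real.exp (-(b + a) * y) = Real.exp (-(b * y)) * Real.exp (-(a * y)) := by
    rw [← Real.exp_add]; ring_nf
  have e3 : Real.exp ((b - a) * -y) = Real.exp (-(b * y)) * Real.exp (a * y) := by
    rw [← Real.exp_add]; ring_nf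
  have e4 : Real.exp (-(b + a) * -y) = Real.exp (b * y) * Real.exp (a * y) := by
    rw [← Real.exp_add]; ring_nf
  have e5 : Real.exp (a * y) * Real.exp (-(a * y)) = 1 := by
    rw [← Real.exp_add]; simp
  simp only [stationary, h1, h2, e1, e2, e3, e4, Real.cosh_eq]
  linear_combination ((A - B) * (Real.exp (b * y) + Real.exp (-(b * y)))
    * Real.exp (-(y ^ 2 / (2 * τ)))) * e5

/-- The gap between the discounted stationary solution and the value of waiting. -/
lemma gap_eq_twoSided (a b A B β x : ℝ) {τ : ℝ≥0} (hτ : τ ≠ 0) :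
    Real.exp ((b ^ 2 - a ^ 2) / 2 * τ) * stationary a b A B x
      - (β * killedTransform a τ (kernelWeight a τ) x
        + killedTransform a τ (fun y => y * kernelWeight a τ y) x)
      = kernelScale a τ x * twoSided
        (fun y => (stationary a b A B y - β - y) * kernelWeight a τ y)
        (fun y => (A - B) * (2 * Real.cosh (b * y) * Real.exp (-(y ^ 2 / (2 * τ))))) (x / τ) := by
  have hw := rapidDecay_kernelWeight a hτ
  have hs := rapidDecay_stationary_mul a b A B a hτ
  have hs' := rapidDecay_stationary_neg_mul a b A B (-a) hτ
  have e1 : (fun y => (stationary a b A B y - β - y) * kernelWeight a τ y)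
      = fun y => stationary a b A B y * kernelWeight a τ y
        - (β * kernelWeight a τ y + y * kernelWeight a τ y) := by
    ext y; ring
  have e2 : (fun y => (A - B) * (2 * Real.cosh (b * y) * Real.exp (-(y ^ 2 / (2 * τ))))
        - (stationary a b A B y - β - y) * kernelWeight a τ y)
      = fun y => stationary a b A B (-y) * kernelWeight (-a) τ y
        + (β * kernelWeight a τ y + y * kernelWeight a τ y) := by
    ext y
    rw [← stationary_symmetrized]
    ring
  rw [exp_mul_stationary a b A B x hτ, twoSided, e1, e2,
    laplace_sub hs ((hw.const_mul β).add hw.id_mul), laplace_add hs' ((hw.const_mul β).add hw.id_mul),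
    laplace_add (hw.const_mul β) hw.id_mul, laplace_add (hw.const_mul β) hw.id_mul,
    laplace_const_mul, laplace_const_mul, killedTransform, killedTransform]
  ring

lemma rapidDecay_gap_data (a b A B β : ℝ) {τ : ℝ≥0} (hτ : τ ≠ 0) :
    RapidDecay (fun y => (stationary a b A B y - β - y) * kernelWeight a τ y) ∧
    RapidDecay (fun y => (A - B) * (2 * Real.cosh (b * y) * Real.exp (-(y ^ 2 / (2 * τ))))) := by
  have hw := rapidDecay_kernelWeight a hτ
  have hs := rapidDecay_stationary_mul a b A B a hτ
  have hs' := rapidDecay_stationary_neg_mul a b A B (-a) hτ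
  constructor
  · convert hs.sub ((hw.const_mul β).add hw.id_mul) using 2 with y
    ring
  · convert hs.add hs' using 2 with y
    rw [stationary_symmetrized]

lemma contDiff_killedTransform (a : ℝ) {τ : ℝ≥0} {f : ℝ → ℝ} (hf : RapidDecay f) :
    ContDiff ℝ 2 (killedTransform a τ f) := by
  have h := contDiff_laplace hf 2
  have h1 : ContDiff ℝ 2 fun x : ℝ => laplace f (x / τ) := h.comp (by fun_prop)
  have h2 : ContDiff ℝ 2 fun x : ℝ => laplace f (-(x / τ)) := h.comp (by fun_prop)
  have := contDiff_kernelScale (n := 2) a τ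
  unfold killedTransform
  fun_prop

lemma hasDerivAt_killedTransform_zero (a : ℝ) {τ : ℝ≥0} {f : ℝ → ℝ} (hf : RapidDecay f) :
    HasDerivAt (killedTransform a τ f)
      (kernelScale a τ 0 * (2 / τ) * laplace (fun y => y * f y) 0) 0 := by
  have hk := ((contDiff_kernelScale (n := 1) a τ).differentiable (by simp) 0).hasDerivAt
  have hd : HasDerivAt (fun x : ℝ => x / (τ : ℝ)) (1 / τ) 0 := (hasDerivAt_id _).div_const _
  have h1 : HasDerivAt (fun x : ℝ => laplace f (x / τ)) _ 0 :=
    (hasDerivAt_laplace hf _).comp 0 hd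
  have h2 : HasDerivAt (fun x : ℝ => laplace f (-(x / τ))) _ 0 :=
    (hasDerivAt_laplace hf _).comp 0 hd.neg
  refine (hk.mul (h1.sub h2)).congr_deriv ?_
  simp only [Pi.sub_apply, zero_div, neg_zero]
  ring

lemma integral_max_neg_le (m a : ℝ) (ha : 0 ≤ a) (τ : ℝ≥0) :
    ∫ y, max (-y) 0 ∂gaussianReal m τ
      ≤ ∫ y, Real.exp (-2 * a * y) * max (-y) 0 ∂gaussianReal m τ := by
  have hid : Integrable (fun y : ℝ => y) (gaussianReal m τ) :=
    memLp_one_iff_integrable.1 (memLp_id_gaussianReal' 1 (by simp))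
  refine integral_mono hid.neg.pos_part ?_ fun y => ?_
  · refine (integrable_exp_mul_gaussianReal (-2 * a - 1)).mono' (by fun_prop)
      (ae_of_all _ fun y => ?_)
    rw [Real.norm_of_nonneg (mul_nonneg (Real.exp_pos _).le (le_max_right _ _)),
      show (-2 * a - 1) * y = -2 * a * y + -y by ring, Real.exp_add]
    gcongr
    exact max_le (by linarith [Real.add_one_le_exp (-y)]) (Real.exp_pos _).le
  · rcases le_total 0 y with hy | hy
    · simp [hy]
    · have : 1 ≤ Real.exp (-2 * a * y) := Real.one_le_exp (by nlinarith)
      exact le_mul_of_one_le_left (le_max_right _ _) this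

/-- For unkilled Y with mean x + aτ, the absorbed mean is E[Y] + E[Y⁻] - E[e^{-2aY} Y⁻], and the
exponential is at least 1 where Y⁻ is nonzero. -/
lemma absorbedMean_le {a σ t : ℝ} (ha : 0 ≤ a) (hσ : 0 ≤ σ) {τ : ℝ≥0}
    (hτ : (τ : ℝ) = σ ^ 2 * t) (x : ℝ) : absorbedMean a σ x t ≤ x + a * τ := by
  have hs : σ * Real.sqrt t = Real.sqrt τ := by
    rw [hτ, Real.sqrt_mul (sq_nonneg σ), Real.sqrt_sq hσ]
  have hid : Integrable (fun y : ℝ => y) (gaussianReal (x + a * τ) τ) :=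
    memLp_one_iff_integrable.1 (memLp_id_gaussianReal' 1 (by simp))
  have h1 : posPartMean (x + a * τ) (Real.sqrt τ)
      = x + a * τ + ∫ y, max (-y) 0 ∂gaussianReal (x + a * τ) τ := by
    have : ∫ y, (y + max (-y) 0) ∂gaussianReal (x + a * τ) τ
        = x + a * τ + ∫ y, max (-y) 0 ∂gaussianReal (x + a * τ) τ := by
      have hneg : Integrable (fun y : ℝ => max (-y) 0) (gaussianReal (x + a * τ) τ) :=
        hid.neg.pos_part
      rw [integral_add hid hneg, integral_id_gaussianReal]
    rw [posPartMean_sqrt, ← this]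
    refine integral_congr_ae (ae_of_all _ fun y => ?_)
    rcases le_total 0 y with hy | hy <;> simp [hy]
  have h2 : Real.exp (-2 * a * x) * posPartMean (a * τ - x) (Real.sqrt τ)
      = ∫ y, Real.exp (-2 * a * y) * max (-y) 0 ∂gaussianReal (x + a * τ) τ := by
    rw [integral_exp_mul_gaussianReal, posPartMean_sqrt,
      show a * (τ : ℝ) - x = -(x + a * τ + -2 * a * τ) by ring, ← gaussianReal_map_neg,
      integral_map (by fun_prop) (by fun_prop)]
    congr 2
    ring
  have h3 := integral_max_neg_le (x + a * τ) a ha τ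
  rw [absorbedMean, hs, mul_assoc a, ← hτ, h1, h2]
  linarith

/-! ### The base solution -/

lemma r₁_add_pos {μ σ ρ : ℝ} (hμ : 0 < μ) (hσ : 0 < σ) (hρ : 0 < ρ) :
    0 < r₁ μ σ ρ ∧ 0 < r₂ μ σ ρ ∧ σ ^ 2 * (r₂ μ σ ρ - r₁ μ σ ρ) = 2 * μ ∧
      σ ^ 2 * (r₁ μ σ ρ * r₂ μ σ ρ) = 2 * ρ ∧ 0 < ρ - μ * r₁ μ σ ρ := by
  have hs : Real.sqrt (μ ^ 2 + 2 * σ ^ 2 * ρ) ^ 2 = μ ^ 2 + 2 * σ ^ 2 * ρ :=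
    Real.sq_sqrt (by positivity)
  have hlt : μ < Real.sqrt (μ ^ 2 + 2 * σ ^ 2 * ρ) :=
    Real.lt_sqrt_of_sq_lt (by have : 0 < 2 * σ ^ 2 * ρ := by positivity
                              linarith)
  unfold r₁ r₂
  set R := Real.sqrt (μ ^ 2 + 2 * σ ^ 2 * ρ)
  have hσ2 : 0 < σ ^ 2 := by positivity
  refine ⟨div_pos (by linarith) hσ2, div_pos (by linarith) hσ2, by field_simp; ring, ?_, ?_⟩
  · field_simp
    linarith
  · have : ρ - μ * ((-μ + R) / σ ^ 2) = (R - μ) ^ 2 / (2 * σ ^ 2) := by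
      field_simp
      linarith
    rw [this]
    have : 0 < R - μ := by linarith
    positivity

/-- The explicit form of the base solution. -/
lemma IsBaseSolution.exists_eq {μ σ ρ : ℝ} (hμ : 0 < μ) (hσ : 0 < σ) (hρ : 0 < ρ) {V₀ : ℝ → ℝ}
    (hV₀ : IsBaseSolution μ σ ρ V₀) : ∃ A : ℝ, 0 < A ∧ ∀ x,
      V₀ x = A * Real.exp (r₁ μ σ ρ * x) - A * Real.exp (-r₂ μ σ ρ * x) := by
  obtain ⟨h1, h2, hdiff, hprod, hpos⟩ := r₁_add_pos hμ hσ hρ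
  have hvalue := hV₀.value
  have hslope := hV₀.slope
  have hu₀ : Real.exp (r₂ μ σ ρ * u₀ μ σ ρ) * (ρ - μ * r₁ μ σ ρ)
      = Real.exp (-r₁ μ σ ρ * u₀ μ σ ρ) * (ρ + μ * r₂ μ σ ρ) := by
    have h : Real.exp ((r₁ μ σ ρ + r₂ μ σ ρ) * u₀ μ σ ρ)
        = (ρ + μ * r₂ μ σ ρ) / (ρ - μ * r₁ μ σ ρ) := by
      rw [u₀, ← mul_assoc, mul_one_div_cancel (by positivity), one_mul,
        Real.exp_log (div_pos (by positivity) hpos)]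
    rw [show r₂ μ σ ρ * u₀ μ σ ρ = -r₁ μ σ ρ * u₀ μ σ ρ + (r₁ μ σ ρ + r₂ μ σ ρ) * u₀ μ σ ρ by ring,
      Real.exp_add, h, mul_assoc, div_mul_cancel₀ _ hpos.ne']
  set r := r₁ μ σ ρ
  set s := r₂ μ σ ρ
  set u := u₀ μ σ ρ
  have hd1 (x) : HasDerivAt V₀ (deriv V₀ x) x :=
    (hV₀.contDiff.differentiable (by simp) x).hasDerivAt
  have hd2 (x) : HasDerivAt (deriv V₀) (deriv (deriv V₀) x) x :=
    (differentiableAt_deriv_of_contDiffAt hV₀.contDiff.contDiffAt).hasDerivAt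
  have hode (x) : deriv (deriv V₀) x + (s - r) * deriv V₀ x - r * s * V₀ x = 0 := by
    have h := hV₀.ode x
    unfold gen at h
    have hσ2 : σ ^ 2 / 2 ≠ 0 := by positivity
    refine mul_left_cancel₀ hσ2 ?_
    linear_combination h + deriv V₀ x / 2 * hdiff - V₀ x / 2 * hprod
  have hexp (k x : ℝ) : HasDerivAt (fun x => Real.exp (k * x)) (k * Real.exp (k * x)) x := by
    have : HasDerivAt (fun x : ℝ => k * x) k x := by simpa using (hasDerivAt_id x).const_mul k
    exact this.exp.congr_deriv (by ring)
  have hconst {f : ℝ → ℝ} (hf : ∀ x, HasDerivAt f 0 x) (x y : ℝ) : f x = f y :=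
    is_const_of_deriv_eq_zero (fun x => (hf x).differentiableAt) (fun x => (hf x).deriv) x y
  -- The two first integrals of the factored equation (D - r)(D + s)V₀ = 0; together they determine
  -- V₀.
  have c1 (x) := hconst (f := fun x => (deriv V₀ x + s * V₀ x) * Real.exp (-r * x))
    (fun x => (((hd2 x).add ((hd1 x).const_mul s)).mul (hexp (-r) x)).congr_deriv (by
      simp only [Pi.add_apply]; linear_combination Real.exp (-r * x) * hode x)) x u
  have c2 (x) := hconst (f := fun x => (deriv V₀ x - r * V₀ x) * Real.exp (s * x))
    (fun x => (((hd2 x).sub ((hd1 x).const_mul r)).mul (hexp s x)).congr_deriv (by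
      simp only [Pi.sub_apply]; linear_combination Real.exp (s * x) * hode x)) x u
  simp only [hvalue, hslope] at c1 c2
  refine ⟨(1 + s * (μ / ρ)) * Real.exp (-r * u) / (r + s), by positivity, fun x => ?_⟩
  -- The logarithm in u₀ is exactly what makes the two coefficients equal, hence V₀(0) = 0.
  have hc : (1 - r * (μ / ρ)) * Real.exp (s * u) = (1 + s * (μ / ρ)) * Real.exp (-r * u) := by
    have k1 : 1 - r * (μ / ρ) = (ρ - μ * r) / ρ := by field_simp
    have k2 : 1 + s * (μ / ρ) = (ρ + μ * s) / ρ := by field_simp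
    rw [k1, k2]
    linear_combination hu₀ / ρ
  have e1 : Real.exp (-r * x) * Real.exp (r * x) = 1 := by rw [← Real.exp_add]; simp
  have e2 : Real.exp (s * x) * Real.exp (-s * x) = 1 := by rw [← Real.exp_add]; simp
  have k1 := c1 x
  have k2 := c2 x
  rw [hc] at k2
  have hrs : r + s ≠ 0 := by positivity
  rw [div_mul_eq_mul_div, div_mul_eq_mul_div, ← sub_div, eq_div_iff hrs]
  linear_combination Real.exp (r * x) * k1 - Real.exp (-s * x) * k2
    - (deriv V₀ x + s * V₀ x) * e1 + (deriv V₀ x - r * V₀ x) * e2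

/-- The slope of the base solution is at least `1`. -/
lemma IsBaseSolution.one_le_deriv {μ σ ρ : ℝ} (hμ : 0 < μ) (hσ : 0 < σ) (hρ : 0 < ρ) {V₀ : ℝ → ℝ}
    (hV₀ : IsBaseSolution μ σ ρ V₀) (x : ℝ) : 1 ≤ deriv V₀ x := by
  obtain ⟨h1, h2, -, -, -⟩ := r₁_add_pos hμ hσ hρ
  obtain ⟨A, hA, hV⟩ := hV₀.exists_eq hμ hσ hρ
  have hslope := hV₀.slope
  have hode := hV₀.ode (u₀ μ σ ρ)
  unfold gen at hode
  rw [hV₀.value, hslope] at hode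
  set r := r₁ μ σ ρ
  set s := r₂ μ σ ρ
  set u := u₀ μ σ ρ
  have hexp (k x : ℝ) : HasDerivAt (fun x => Real.exp (k * x)) (k * Real.exp (k * x)) x := by
    have : HasDerivAt (fun x : ℝ => k * x) k x := by simpa using (hasDerivAt_id x).const_mul k
    exact this.exp.congr_deriv (by ring)
  have hd : deriv V₀ = fun x => A * (r * Real.exp (r * x)) + A * (s * Real.exp (-s * x)) := by
    ext x
    rw [funext hV]
    exact ((((hexp r x).const_mul A).sub ((hexp (-s) x).const_mul A)).congr_deriv (by ring)).deriv
  have hdd : deriv (deriv V₀) u = A * (r * (r * Real.exp (r * u)))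
      - A * (s * (s * Real.exp (-s * u))) := by
    rw [hd]
    exact ((((hexp r u).const_mul r).const_mul A).add
      (((hexp (-s) u).const_mul s).const_mul A)).congr_deriv (by ring) |>.deriv
  -- At u₀ the equation reads (σ²/2)V₀'' + μ = ρ · μ/ρ. So V₀', a positive combination of
  -- exponentials and thus convex, has its minimum 1 there; the tangent-line bounds below make this
  -- explicit.
  have hzero : deriv (deriv V₀) u = 0 := by
    have : σ ^ 2 / 2 * deriv (deriv V₀) u = 0 := by
      rw [mul_div_cancel₀ _ hρ.ne'] at hode
      linarith
    exact (mul_eq_zero.1 this).resolve_left (by positivity)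
  rw [hdd] at hzero
  rw [hd] at hslope ⊢
  have e1 : Real.exp (r * x) = Real.exp (r * u) * Real.exp (r * (x - u)) := by
    rw [← Real.exp_add]; ring_nf
  have e2 : Real.exp (-s * x) = Real.exp (-s * u) * Real.exp (-s * (x - u)) := by
    rw [← Real.exp_add]; ring_nf
  simp only at hslope ⊢
  rw [e1, e2]
  have k1 := mul_le_mul_of_nonneg_left (Real.add_one_le_exp (r * (x - u)))
    (by positivity : 0 ≤ A * (r * Real.exp (r * u)))
  have k2 := mul_le_mul_of_nonneg_left (Real.add_one_le_exp (-s * (x - u)))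
    (by positivity : 0 ≤ A * (s * Real.exp (-s * u)))
  linear_combination k1 + k2 - hslope - (x - u) * hzero

/-! ### Gluing along a point -/

/-- Gluing two `C¹` functions with equal value and slope. -/
lemma hasDerivAt_ite_le {f g : ℝ → ℝ} {c : ℝ} (hf : Differentiable ℝ f) (hg : Differentiable ℝ g)
    (hfg : f c = g c) (hfg' : deriv f c = deriv g c) (x : ℝ) :
    HasDerivAt (fun x => if x ≤ c then f x else g x) (if x ≤ c then deriv f x else deriv g x) x := by
  rcases lt_trichotomy x c with h | rfl | h
  · rw [if_pos h.le]
    refine (hf x).hasDerivAt.congr_of_eventuallyEq ?_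
    filter_upwards [Iio_mem_nhds h] with y hy
    rw [if_pos (le_of_lt hy)]
  · rw [if_pos le_rfl]
    have h1 : HasDerivWithinAt (fun y => if y ≤ x then f y else g y) (deriv f x) (Iic x) x :=
      (hf x).hasDerivAt.hasDerivWithinAt.congr (fun y hy => if_pos hy) (if_pos le_rfl)
    have h2 : HasDerivWithinAt (fun y => if y ≤ x then f y else g y) (deriv f x) (Ici x) x := by
      rw [hfg']
      refine (hg x).hasDerivAt.hasDerivWithinAt.congr (fun y hy => ?_) (by rw [if_pos le_rfl, hfg])
      rcases (mem_Ici.1 hy).eq_or_lt with rfl | hlt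
      · rw [if_pos le_rfl, hfg]
      · rw [if_neg (not_le.2 hlt)]
    have := h1.union h2
    rwa [Iic_union_Ici, hasDerivWithinAt_univ] at this
  · rw [if_neg (not_le.2 h)]
    refine (hg x).hasDerivAt.congr_of_eventuallyEq ?_
    filter_upwards [Ioi_mem_nhds h] with y hy
    rw [if_neg (not_le.2 hy)]

lemma contDiff_ite_le {f g : ℝ → ℝ} {c : ℝ} (hf : ContDiff ℝ 1 f) (hg : ContDiff ℝ 1 g)
    (hfg : f c = g c) (hfg' : deriv f c = deriv g c) :
    ContDiff ℝ 1 fun x => if x ≤ c then f x else g x := by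
  have hd := hasDerivAt_ite_le (hf.differentiable (by simp)) (hg.differentiable (by simp)) hfg hfg'
  rw [contDiff_one_iff_deriv]
  refine ⟨fun x => (hd x).differentiableAt, ?_⟩
  rw [funext fun x => (hd x).deriv]
  exact (hf.continuous_deriv le_rfl).if_le (hg.continuous_deriv le_rfl) continuous_id
    continuous_const fun x hx => by rw [hx, hfg']

/-- A glued function is not twice differentiable where the second derivatives differ. -/
lemma not_contDiffAt_ite_le {f g : ℝ → ℝ} {c : ℝ} (hf : ContDiff ℝ 1 f) (hg : ContDiff ℝ 1 g)
    (hf2 : DifferentiableAt ℝ (deriv f) c) (hg2 : DifferentiableAt ℝ (deriv g) c)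
    (hfg : f c = g c) (hfg' : deriv f c = deriv g c)
    (hne : deriv (deriv f) c ≠ deriv (deriv g) c) :
    ¬ ContDiffAt ℝ 2 (fun x => if x ≤ c then f x else g x) c := by
  intro h
  have hd := hasDerivAt_ite_le (hf.differentiable (by simp)) (hg.differentiable (by simp)) hfg hfg'
  have h2 := (differentiableAt_deriv_of_contDiffAt h).hasDerivAt
  rw [funext fun x => (hd x).deriv] at h2
  set d := deriv (fun x => if x ≤ c then deriv f x else deriv g x) c
  have e1 : deriv (deriv f) c = d := by
    refine (uniqueDiffWithinAt_Iic c).eq_deriv _ hf2.hasDerivAt.hasDerivWithinAt ?_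
    exact (h2.hasDerivWithinAt (s := Iic c)).congr (fun y hy => (if_pos hy).symm)
      (if_pos le_rfl).symm
  have e2 : deriv (deriv g) c = d := by
    refine (uniqueDiffWithinAt_Ici c).eq_deriv _ hg2.hasDerivAt.hasDerivWithinAt ?_
    refine (h2.hasDerivWithinAt (s := Ici c)).congr (fun y hy => ?_) (by rw [if_pos le_rfl, hfg'])
    rcases (mem_Ici.1 hy).eq_or_lt with rfl | hlt
    · rw [if_pos le_rfl, hfg']
    · rw [if_neg (not_le.2 hlt)]
  exact hne (e1.trans e2.symm)

/-! ### The extremal translate and its contact point -/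

lemma sub_le_sub_of_one_le_deriv {V : ℝ → ℝ} (hV : Differentiable ℝ V)
    (hV1 : ∀ x, 1 ≤ deriv V x) {x y : ℝ} (hxy : x ≤ y) : y - x ≤ V y - V x := by
  have h : Monotone fun x => V x - x := by
    refine monotone_of_deriv_nonneg (hV.sub differentiable_id) fun x => ?_
    have : HasDerivAt (fun x => V x - x) (deriv V x - 1) x :=
      (hV x).hasDerivAt.sub (hasDerivAt_id x)
    rw [this.deriv]
    linarith [hV1 x]
  have := h hxy
  simp only at this
  linarith

/-- The extremal translate of `e V` above `g` touches `g`. -/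
lemma exists_touching {V g : ℝ → ℝ} {u e β κ : ℝ} (hV : Differentiable ℝ V)
    (hV1 : ∀ x, 1 ≤ deriv V x) (hV0 : V 0 = 0) (hu : 0 < V u) (he : 1 < e) (hg : Continuous g)
    (hg0 : g 0 = 0) (hgle : ∀ x, 0 ≤ x → g x ≤ β + x + κ) {g' : ℝ} (hg' : HasDerivAt g g' 0)
    (hslope : e * deriv V 0 < g') {z : ℝ}
    (hz : z = sSup {z : ℝ | ∀ x : ℝ, 0 ≤ x → g x ≤ e * V (x - z + u)}) :
    z < u ∧ (∀ x, 0 ≤ x → g x ≤ e * V (x - z + u)) ∧ ∃ x, 0 ≤ x ∧ g x = e * V (x - z + u) := by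
  set Z := {z : ℝ | ∀ x : ℝ, 0 ≤ x → g x ≤ e * V (x - z + u)} with hZ
  have hVc := hV.continuous
  have hgrow (x z : ℝ) (h : z ≤ x) : e * (V u + (x - z)) ≤ e * V (x - z + u) := by
    have := sub_le_sub_of_one_le_deriv hV hV1 (by linarith : u ≤ x - z + u)
    exact mul_le_mul_of_nonneg_left (by linarith) (by linarith)
  have hbdd : BddAbove Z := by
    refine ⟨u, fun w hw => ?_⟩
    have h := hw 0 le_rfl
    rw [hg0] at h
    by_contra hcon
    rw [not_le] at hcon
    have h1 := sub_le_sub_of_one_le_deriv hV hV1 (by linarith : 0 - w + u ≤ 0)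
    nlinarith
  have hne : Z.Nonempty := by
    refine ⟨min 0 (-(β + κ)), fun x hx => (hgle x hx).trans ?_⟩
    have h0 : min 0 (-(β + κ)) ≤ 0 := min_le_left _ _
    have h1 : min 0 (-(β + κ)) ≤ -(β + κ) := min_le_right _ _
    have := hgrow x (min 0 (-(β + κ))) (by linarith)
    nlinarith
  have hclosed : IsClosed Z := by
    have : Z = ⋂ x : ℝ, ⋂ _ : 0 ≤ x, {z | g x ≤ e * V (x - z + u)} := by
      ext; simp [hZ]
    rw [this]
    exact isClosed_iInter fun x => isClosed_iInter fun _ =>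
      isClosed_le continuous_const (by fun_prop)
  have hzZ : z ∈ Z := hz ▸ hclosed.csSup_mem hne hbdd
  have hle : z ≤ u := by
    have h := hzZ 0 le_rfl
    rw [hg0] at h
    by_contra hcon
    rw [not_le] at hcon
    have h1 := sub_le_sub_of_one_le_deriv hV hV1 (by linarith : 0 - z + u ≤ 0)
    nlinarith
  -- If z = u, both curves start at 0 and g is steeper there, so it would cross the translate at
  -- once.
  have hlt : z < u := by
    refine lt_of_le_of_ne hle fun h => ?_
    have hd : HasDerivWithinAt (fun x => e * V x - g x) (e * deriv V 0 - g') (Ioi 0) 0 :=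
      (((hV 0).hasDerivAt.const_mul e).sub hg').hasDerivWithinAt
    rw [hasDerivWithinAt_iff_tendsto_slope' (by simp)] at hd
    have := ge_of_tendsto (b := 0) hd (by
      filter_upwards [self_mem_nhdsWithin] with x hx
      have h1 := hzZ x (le_of_lt hx)
      rw [h, sub_add_cancel] at h1
      rw [slope_def_field, hV0, hg0]
      refine div_nonneg (by linarith) ?_
      rw [mem_Ioi] at hx
      linarith)
    linarith
  refine ⟨hlt, hzZ, ?_⟩
  -- Past R the growth rate e > 1 beats the slope 1 of the bound on g, for all shifts up to z + 1.
  -- Points violating a larger shift therefore stay in a compact set and accumulate at a contact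
  -- point.
  set R := max (z + 1) (max 0 ((β + κ + e * (z + 1)) / (e - 1))) with hR
  have hbig (w x : ℝ) (hw : w ≤ z + 1) (hx : R ≤ x) : g x ≤ e * V (x - w + u) := by
    have h1 : z + 1 ≤ x := (le_max_left _ _).trans hx
    have h2 : 0 ≤ x := ((le_max_left _ _).trans (le_max_right _ _)).trans hx
    have h3 : (β + κ + e * (z + 1)) / (e - 1) ≤ x :=
      ((le_max_right _ _).trans (le_max_right _ _)).trans hx
    rw [div_le_iff₀ (by linarith)] at h3
    have h4 := hgrow x w (by linarith)
    have h5 := hgle x h2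
    nlinarith
  have hex (n : ℕ) : ∃ x ∈ Icc 0 R, e * V (x - (z + 1 / (n + 1)) + u) < g x := by
    have hpos : (0 : ℝ) < 1 / (n + 1) := by positivity
    have hn : z + 1 / (n + 1 : ℝ) ∉ Z := fun h => by
      have := le_csSup hbdd h
      rw [← hz] at this
      linarith
    simp only [hZ, mem_ofPred_eq, not_forall, not_le] at hn
    obtain ⟨x, hx, hlt⟩ := hn
    refine ⟨x, ⟨hx, ?_⟩, hlt⟩
    by_contra hcon
    have h1 : (1 : ℝ) / (n + 1) ≤ 1 := by
      rw [div_le_one (by positivity)]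
      linarith [(Nat.cast_nonneg n : (0 : ℝ) ≤ n)]
    have := hbig (z + 1 / (n + 1)) x (by linarith) (not_le.1 hcon).le
    linarith
  choose y hyR hy using hex
  obtain ⟨x, hx, φ, hφ, hlim⟩ := isCompact_Icc.tendsto_subseq hyR
  refine ⟨x, hx.1, le_antisymm (hzZ x hx.1) ?_⟩
  have hz' : Filter.Tendsto (fun n : ℕ => z + 1 / ((φ n : ℝ) + 1)) Filter.atTop (nhds z) := by
    simpa using (tendsto_one_div_add_atTop_nhds_zero_nat.comp hφ.tendsto_atTop).const_add z
  have h1 : Filter.Tendsto (fun n => e * V (y (φ n) - (z + 1 / ((φ n : ℝ) + 1)) + u))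
      Filter.atTop (nhds (e * V (x - z + u))) :=
    ((hVc.tendsto _).comp ((hlim.sub hz').add_const u)).const_mul e
  exact le_of_tendsto_of_tendsto' h1 ((hg.tendsto _).comp hlim) fun n => (hy (φ n)).le

/-! ### Second derivative of the gap at a contact point -/

lemma deriv_deriv_mul_of_double_zero {k φ : ℝ → ℝ} {x : ℝ} (hk : ContDiff ℝ 2 k)
    (hφ : ContDiff ℝ 2 φ) (h0 : φ x = 0) (h1 : deriv φ x = 0) :
    deriv (deriv fun y => k y * φ y) x = k x * deriv (deriv φ) x := by
  have hkd (y) := (hk.differentiable (by simp) y).hasDerivAt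
  have hφd (y) := (hφ.differentiable (by simp) y).hasDerivAt
  have hkdd := (differentiableAt_deriv_of_contDiffAt hk.contDiffAt (x := x)).hasDerivAt
  have hφdd := (differentiableAt_deriv_of_contDiffAt hφ.contDiffAt (x := x)).hasDerivAt
  have hd : (deriv fun y => k y * φ y) = fun y => deriv k y * φ y + k y * deriv φ y :=
    funext fun y => ((hkd y).mul (hφd y)).deriv
  rw [hd]
  refine (((hkdd.mul (hφd x)).add ((hkd x).mul hφdd)).congr_deriv ?_).deriv
  rw [h0, h1]
  ring

lemma contDiff_twoSided {q n : ℝ → ℝ} (hq : RapidDecay q) (hn : RapidDecay n) :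
    ContDiff ℝ 2 (twoSided q n) := by
  have h1 := contDiff_laplace hq 2
  have h2 : ContDiff ℝ 2 fun θ => laplace (fun y => n y - q y) (-θ) :=
    (contDiff_laplace (hn.sub hq) 2).comp contDiff_neg
  exact h1.add h2

/-- A product of a positive function and a rescaled two-sided transform has only nondegenerate
double zeros. -/
lemma deriv_deriv_scaled_twoSided_pos {k q n : ℝ → ℝ} {τ x y₀ : ℝ} (hk : ContDiff ℝ 2 k)
    (hkx : 0 < k x) (hq : RapidDecay q) (hn : RapidDecay n) (hτ : 0 < τ) (hx : 0 < x)
    (hy₀ : 0 ≤ y₀) (hneg : ∀ y, 0 < y → y < y₀ → q y ≤ 0) (hpos : ∀ y, y₀ ≤ y → 0 ≤ q y)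
    (hn0 : ∀ y, 0 < y → 0 < n y) (h0 : k x * twoSided q n (x / τ) = 0)
    (h1 : deriv (fun y => k y * twoSided q n (y / τ)) x = 0) :
    0 < deriv (deriv fun y => k y * twoSided q n (y / τ)) x := by
  have hT := contDiff_twoSided hq hn
  have hφ : ContDiff ℝ 2 fun y => twoSided q n (y / τ) := hT.comp (by fun_prop)
  have hdiv (y : ℝ) : HasDerivAt (fun y : ℝ => y / τ) (1 / τ) y := (hasDerivAt_id y).div_const τ
  have hd : (deriv fun y => twoSided q n (y / τ)) = fun y => deriv (twoSided q n) (y / τ) * (1 / τ) :=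
    funext fun y => (HasDerivAt.comp (h₂ := twoSided q n) y
      (hT.differentiable (by simp) (y / τ)).hasDerivAt (hdiv y)).deriv
  have hdd : deriv (deriv fun y => twoSided q n (y / τ)) x
      = deriv (deriv (twoSided q n)) (x / τ) * (1 / τ) * (1 / τ) := by
    rw [hd]
    exact (((differentiableAt_deriv_of_contDiffAt hT.contDiffAt).hasDerivAt.comp x
      (hdiv x)).mul_const (1 / τ)).deriv
  have z0 : twoSided q n (x / τ) = 0 := (mul_eq_zero.1 h0).resolve_left hkx.ne'
  have z1 : deriv (fun y => twoSided q n (y / τ)) x = 0 := by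
    have h := ((hk.differentiable (by simp) x).hasDerivAt.mul
      (hφ.differentiable (by simp) x).hasDerivAt).deriv
    rw [z0, mul_zero, zero_add] at h
    exact (mul_eq_zero.1 (h.symm.trans h1)).resolve_left hkx.ne'
  have z1' : deriv (twoSided q n) (x / τ) = 0 := by
    rw [hd] at z1
    exact (mul_eq_zero.1 z1).resolve_right (by positivity)
  rw [deriv_deriv_mul_of_double_zero hk hφ z0 z1, hdd]
  have := deriv_deriv_twoSided_pos hq hn (div_pos hx hτ) hy₀ hneg hpos hn0 z0 z1'
  positivity

/-- The slopes at `0` of the survival probability, the absorbed mean and the stationary solution. -/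
lemma killed_slopes (a b A : ℝ) {τ : ℝ≥0} (hτ : τ ≠ 0)
    (hV : ∀ y, 0 ≤ y → y ≤ stationary a b A A y) {s m w : ℝ}
    (hs : HasDerivAt (killedTransform a τ (kernelWeight a τ)) s 0)
    (hm : HasDerivAt (killedTransform a τ fun y => y * kernelWeight a τ y) m 0)
    (hw : HasDerivAt (stationary a b A A) w 0) :
    0 < s ∧ m ≤ Real.exp ((b ^ 2 - a ^ 2) / 2 * τ) * w := by
  have hτ' : (0 : ℝ) < τ := by positivity
  have hk := rapidDecay_kernelWeight a hτ
  have hst := rapidDecay_stationary_mul a b A A a hτ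
  have hkpos (y : ℝ) : 0 < kernelWeight a τ y := Real.exp_pos _
  have hscale : 0 < kernelScale a τ 0 * (2 / τ) := mul_pos (kernelScale_pos a 0 hτ) (by positivity)
  have e1 := hs.unique (hasDerivAt_killedTransform_zero a hk)
  have e2 := hm.unique (hasDerivAt_killedTransform_zero a hk.id_mul)
  -- A stationary solution vanishing at 0 is also an eigenfunction of the killed semigroup, so the
  -- slope inequality reduces to y ≤ V(y) under the integral.
  have heq : (fun x => Real.exp ((b ^ 2 - a ^ 2) / 2 * τ) * stationary a b A A x)
      = killedTransform a τ fun y => stationary a b A A y * kernelWeight a τ y := by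
    ext x
    have hodd : (fun y => stationary a b A A (-y) * kernelWeight (-a) τ y)
        = fun y => -1 * (stationary a b A A y * kernelWeight a τ y) := by
      ext y
      have := stationary_symmetrized a b A A y τ
      rw [sub_self, zero_mul] at this
      linarith
    rw [exp_mul_stationary a b A A x hτ, hodd, laplace_const_mul, killedTransform]
    ring
  have e3 := (hw.const_mul (Real.exp ((b ^ 2 - a ^ 2) / 2 * τ))).unique
    (heq ▸ hasDerivAt_killedTransform_zero a hst)
  rw [e1, e2, e3]
  constructor
  · refine mul_pos hscale ?_
    have hi := hk.id_mul.integrableOn 0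
    rw [laplace, setIntegral_pos_iff_support_of_nonneg_ae
      ((ae_restrict_mem measurableSet_Ioi).mono fun y hy => ?_) hi]
    · have : Function.support (fun y => Real.exp (0 * y) * (y * kernelWeight a τ y)) ∩ Ioi 0
          = Ioi 0 := inter_eq_right.2 fun y hy => by
        have h1 := hkpos y
        have h2 : 0 < y := hy
        exact (by positivity : 0 < Real.exp (0 * y) * (y * kernelWeight a τ y)).ne'
      rw [this]
      simp
    · have h1 := hkpos y
      have h2 : 0 < y := hy
      exact (by positivity : 0 ≤ Real.exp (0 * y) * (y * kernelWeight a τ y))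
  · refine mul_le_mul_of_nonneg_left ?_ hscale.le
    refine setIntegral_mono_on (hk.id_mul.id_mul.integrableOn 0) (hst.id_mul.integrableOn 0)
      measurableSet_Ioi fun y hy => ?_
    have h1 := hkpos y
    have h2 : 0 < y := hy
    have h3 := hV y h2.le
    have h4 : y * (y * kernelWeight a τ y)
        ≤ y * (stationary a b A A y * kernelWeight a τ y) := by gcongr
    exact mul_le_mul_of_nonneg_left h4 (Real.exp_pos _).le

lemma stationary_shift (a b A x d : ℝ) : stationary a b A A (x + d)
    = stationary a b (A * Real.exp ((b - a) * d)) (A * Real.exp (-(b + a) * d)) x := by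
  unfold stationary
  rw [mul_add, mul_add, Real.exp_add, Real.exp_add]
  ring

lemma exists_sign_change {F : ℝ → ℝ} (hF : Continuous F) (hmono : Monotone F) {u : ℝ} (hu : 0 ≤ u)
    (h : 0 ≤ F u) : ∃ y₀, 0 ≤ y₀ ∧ (∀ y, 0 < y → y < y₀ → F y ≤ 0) ∧ ∀ y, y₀ ≤ y → 0 ≤ F y := by
  rcases le_or_gt 0 (F 0) with h0 | h0
  · exact ⟨0, le_rfl, fun y h1 h2 => absurd h1 (not_lt.2 h2.le), fun y hy => h0.trans (hmono hy)⟩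
  · obtain ⟨y₀, hy₀, hz⟩ := intermediate_value_Icc hu hF.continuousOn ⟨h0.le, h⟩
    exact ⟨y₀, hy₀.1, fun y _ hy => hz ▸ hmono hy.le, fun y hy => hz ▸ hmono hy⟩

/-- Three functions glued in `C¹` fashion, with a jump of the second derivative at `c`. -/
lemma contDiff_glued {f g k : ℝ → ℝ} {c z : ℝ} (hf : ContDiff ℝ 2 f) (hg : ContDiff ℝ 2 g)
    (hk : ContDiff ℝ 2 k) (hcz : c < z) (hgk : g z = k z) (hgk' : deriv g z = deriv k z)
    (hfg : f c = g c) (hfg' : deriv f c = deriv g c)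
    (hne : deriv (deriv f) c ≠ deriv (deriv g) c) :
    ContDiff ℝ 1 (fun x => if x ≤ c then f x else if x ≤ z then g x else k x) ∧
      ¬ ContDiffAt ℝ 2 (fun x => if x ≤ c then f x else if x ≤ z then g x else k x) c := by
  have hr : ContDiff ℝ 1 fun x => if x ≤ z then g x else k x :=
    contDiff_ite_le (hg.of_le (by norm_num)) (hk.of_le (by norm_num)) hgk hgk'
  have hev : (fun x => if x ≤ z then g x else k x) =ᶠ[nhds c] g := by
    filter_upwards [Iio_mem_nhds hcz] with x hx
    exact if_pos (le_of_lt hx)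
  have hf1 : ContDiff ℝ 1 f := hf.of_le (by norm_num)
  rw [← hev.self_of_nhds] at hfg
  rw [← hev.deriv_eq] at hfg'
  rw [← hev.deriv.deriv_eq] at hne
  exact ⟨contDiff_ite_le hf1 hr hfg hfg', not_contDiffAt_ite_le hf1 hr
    (differentiableAt_deriv_of_contDiffAt hf.contDiffAt)
    ((differentiableAt_deriv_of_contDiffAt hg.contDiffAt).congr_of_eventuallyEq hev.deriv)
    hfg hfg' hne⟩

/-- At a touching point of the stationary solution and the value of waiting, the second derivatives
differ. -/
lemma deriv_deriv_gap_pos {a b A β d u x : ℝ} {τ : ℝ≥0} (hτ : τ ≠ 0)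
    (hpos : 0 < stationary a b A A d)
    (hmono : Monotone fun y => stationary a b A A (y + d) - β - y) (hu : 0 ≤ u)
    (hFu : 0 ≤ stationary a b A A (u + d) - β - u) (hx : 0 < x)
    (h0 : Real.exp ((b ^ 2 - a ^ 2) / 2 * τ) * stationary a b A A (x + d)
      - (β * killedTransform a τ (kernelWeight a τ) x
        + killedTransform a τ (fun y => y * kernelWeight a τ y) x) = 0)
    (h1 : deriv (fun x => Real.exp ((b ^ 2 - a ^ 2) / 2 * τ) * stationary a b A A (x + d)
      - (β * killedTransform a τ (kernelWeight a τ) x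
        + killedTransform a τ (fun y => y * kernelWeight a τ y) x)) x = 0) :
    0 < deriv (deriv (fun x => Real.exp ((b ^ 2 - a ^ 2) / 2 * τ) * stationary a b A A (x + d)
      - (β * killedTransform a τ (kernelWeight a τ) x
        + killedTransform a τ (fun y => y * kernelWeight a τ y) x))) x := by
  set A₁ := A * Real.exp ((b - a) * d) with hA₁
  set A₂ := A * Real.exp (-(b + a) * d) with hA₂
  have hA : 0 < A₁ - A₂ := by
    have : stationary a b A A d = A₁ - A₂ := rfl
    rwa [← this]
  simp_rw [stationary_shift, ← hA₁, ← hA₂] at hmono hFu h0 h1 ⊢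
  simp_rw [gap_eq_twoSided a b A₁ A₂ β _ hτ] at h0 h1 ⊢
  have hc : Continuous fun y => stationary a b A₁ A₂ y - β - y := by
    unfold stationary
    fun_prop
  obtain ⟨y₀, hy₀, hneg, hnonneg⟩ := exists_sign_change hc hmono hu hFu
  obtain ⟨hq, hn⟩ := rapidDecay_gap_data a b A₁ A₂ β hτ
  have hk (y : ℝ) : 0 < kernelWeight a τ y := Real.exp_pos _
  exact deriv_deriv_scaled_twoSided_pos (contDiff_kernelScale a τ) (kernelScale_pos a x hτ) hq hn
    (by positivity) hx hy₀ (fun y h h' => mul_nonpos_of_nonpos_of_nonneg (hneg y h h') (hk y).le)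
    (fun y h => mul_nonneg (hnonneg y h) (hk y).le)
    (fun y _ => mul_pos hA (mul_pos (by linarith [Real.cosh_pos (b * y)]) (Real.exp_pos _))) h0 h1

end

end PeuraKeppo

/-! ### The theorem -/

set_option maxHeartbeats 1000000 in
theorem proposition4p2
    {Ω : Type*} [MeasurableSpace Ω] (P : Measure Ω) [IsProbabilityMeasure P]
    (W : ℝ≥0 → Ω → ℝ) (hW : IsBrownianReal W P)
    (μ σ ρ K Δ : ℝ) (hμ : 0 < μ) (hσ : 0 < σ) (hρ : 0 < ρ) (hK : 0 ≤ K) (hΔ : 0 < Δ)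
    (V₀ : ℝ → ℝ) (hV₀ : PeuraKeppo.IsBaseSolution μ σ ρ V₀)
    (h : ℝ → ℝ → ℝ) (hh : PeuraKeppo.IsDirichletSolution μ σ h)
    (p : ℝ → ℝ → ℝ) (hp : p = PeuraKeppo.ruinProb P W μ σ)
    (hcost : K < μ / ρ - PeuraKeppo.u₀ μ σ ρ - PeuraKeppo.betaCrit ρ V₀ p h Δ)
    (β : ℝ) (hβ : PeuraKeppo.betaCrit ρ V₀ p h Δ < β)
    (hβK : β + PeuraKeppo.upper μ σ ρ V₀ p h β Δ = μ / ρ - K)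
    (u₁ : ℝ) (hu₁ : u₁ = PeuraKeppo.lower μ σ ρ V₀ p h β Δ)
    (V : ℝ → ℝ) (hV : V = PeuraKeppo.value μ σ ρ V₀ p h β Δ) :
    0 < u₁ ∧ ContDiffOn ℝ 1 V (Ici 0) ∧ ¬ ContDiffAt ℝ 2 V u₁ := by
  open PeuraKeppo in
  obtain ⟨hr₁, hr₂, hdiff, hprod, -⟩ := r₁_add_pos hμ hσ hρ
  obtain ⟨A, hA, hVA⟩ := hV₀.exists_eq hμ hσ hρ
  -- Then a = μ/σ², and b is the half-sum for which the exponents of V₀ are b - a and -(b + a).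
  set a := (r₂ μ σ ρ - r₁ μ σ ρ) / 2 with ha_def
  set b := (r₁ μ σ ρ + r₂ μ σ ρ) / 2 with hb_def
  have hba : b - a = r₁ μ σ ρ := by rw [ha_def, hb_def]; ring
  have hab : b + a = r₂ μ σ ρ := by rw [ha_def, hb_def]; ring
  have haσ : a * σ ^ 2 = μ := by rw [ha_def]; linarith
  have ha : 0 < a := pos_of_mul_pos_left (haσ ▸ hμ) (sq_nonneg σ)
  have hVs : V₀ = stationary a b A A := by
    ext x
    rw [hVA, stationary, hba, hab]
  set v : ℝ≥0 := (σ ^ 2).toNNReal with hv_def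
  have hv : (v : ℝ) = σ ^ 2 := Real.coe_toNNReal _ (sq_nonneg σ)
  have hv0 : v ≠ 0 := by
    rw [hv_def, Ne, Real.toNNReal_eq_zero, not_le]; positivity
  set τ : ℝ≥0 := v * Δ.toNNReal with hτ_def
  have hτ : (τ : ℝ) = σ ^ 2 * Δ := by
    rw [hτ_def, NNReal.coe_mul, hv, Real.coe_toNNReal _ hΔ.le]
  have hτ0 : τ ≠ 0 := mul_ne_zero hv0 (by simpa using hΔ)
  have hexp : Real.exp ((b ^ 2 - a ^ 2) / 2 * τ) = Real.exp (ρ * Δ) := by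
    congr 1
    rw [show b ^ 2 - a ^ 2 = (b - a) * (b + a) by ring, hba, hab, hτ]
    linear_combination Δ / 2 * hprod
  set E := Real.exp (ρ * Δ) with hE
  have hE1 : 1 + ρ * Δ < E := by
    have := Real.add_one_lt_exp (mul_pos hρ hΔ).ne'
    linarith
  have hρΔ : 0 < ρ * Δ := mul_pos hρ hΔ
  set S := killedTransform a τ (kernelWeight a τ) with hS_def
  set M := killedTransform a τ (fun y => y * kernelWeight a τ y) with hM_def
  have hk := rapidDecay_kernelWeight a hτ0
  have hS2 : ContDiff ℝ 2 S := contDiff_killedTransform a hk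
  have hM2 : ContDiff ℝ 2 M := contDiff_killedTransform a hk.id_mul
  have hpS (x : ℝ) (hx : 0 ≤ x) : p x Δ = 1 - S x := by
    rw [hp, ruinProb_eq hW ha.le hv0 hv (by rw [hv, haσ]) hΔ hx,
      surv_eq_killedTransform a x (τ := v * Δ.toNNReal) hτ0]
  have hhM (x : ℝ) (hx : 0 ≤ x) : h x Δ = M x := by
    have hh' : IsDirichletSolution (a * σ ^ 2) σ h := haσ.symm ▸ hh
    rw [hh'.eq_absorbedMean ha.le hσ hx hΔ.le,
      absorbedMean_eq_killedTransform a x hσ.le hτ0 hτ]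
  have hVd : Differentiable ℝ V₀ := hV₀.contDiff.differentiable (by simp)
  have hV1 := hV₀.one_le_deriv hμ hσ hρ
  have hV00 : V₀ 0 = 0 := by rw [hVA]; simp
  have hVu : V₀ (u₀ μ σ ρ) = μ / ρ := hV₀.value
  have hVpos {x : ℝ} (hx : 0 < x) : 0 < V₀ x := by
    have := sub_le_sub_of_one_le_deriv hVd hV1 hx.le
    linarith
  set s := deriv S 0 with hs_def
  set m := deriv M 0 with hm_def
  have hsd : HasDerivAt S s 0 := (hS2.differentiable (by simp) 0).hasDerivAt
  have hmd : HasDerivAt M m 0 := (hM2.differentiable (by simp) 0).hasDerivAt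
  obtain ⟨hs, hmw⟩ := killed_slopes a b A (w := deriv V₀ 0) hτ0 (fun y hy => by
    have := sub_le_sub_of_one_le_deriv hVd hV1 hy
    rw [hV00, hVs] at this
    linarith) hsd hmd (hVs ▸ (hVd 0).hasDerivAt)
  rw [hexp] at hmw
  have hcrit : betaCrit ρ V₀ p h Δ = (E * deriv V₀ 0 - m) / s := by
    have d1 : derivWithin (fun x => h x Δ) (Ici 0) 0 = m := by
      rw [derivWithin_congr (s := Ici 0) (f := M) (fun x hx => hhM x hx) (hhM 0 le_rfl)]
      exact hmd.hasDerivWithinAt.derivWithin (uniqueDiffWithinAt_Ici 0)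
    have d2 : derivWithin (fun x => p x Δ) (Ici 0) 0 = -s := by
      rw [derivWithin_congr (s := Ici 0) (f := fun x => 1 - S x) (fun x hx => hpS x hx) (hpS 0 le_rfl)]
      exact (hsd.const_sub 1).hasDerivWithinAt.derivWithin (uniqueDiffWithinAt_Ici 0)
    rw [betaCrit, d1, d2, div_neg, ← neg_div, neg_sub]
  -- `killed_slopes` makes β(Δ) nonnegative. Positivity of β is needed to bound βS by β.
  have hβ0 : 0 < β := by
    refine lt_of_le_of_lt ?_ hβ
    rw [hcrit]
    exact div_nonneg (by linarith) hs.le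
  have hslope : E * deriv V₀ 0 < β * s + m := by
    rw [hcrit, div_lt_iff₀ hs] at hβ
    linarith
  set g : ℝ → ℝ := fun x => β * S x + M x with hg_def
  have hgp (x : ℝ) (hx : 0 ≤ x) : β * (1 - p x Δ) + h x Δ = g x := by
    rw [hpS x hx, hhM x hx, sub_sub_cancel]
  have hg2 : ContDiff ℝ 2 g := (contDiff_const.mul hS2).add hM2
  have hg0 : g 0 = 0 := by simp [hg_def, hS_def, hM_def, killedTransform]
  have hgle (x : ℝ) : g x ≤ β + x + μ * Δ := by
    have h1 : S x ≤ 1 := by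
      rw [hS_def, ← surv_eq_killedTransform a x hτ0]
      exact surv_le_one _ _ _
    have h2 : M x ≤ x + μ * Δ := by
      rw [hM_def, ← absorbedMean_eq_killedTransform a x hσ.le hτ0 hτ]
      refine (absorbedMean_le ha.le hσ.le hτ x).trans (le_of_eq ?_)
      rw [hτ, ← haσ]; ring
    have := mul_le_mul_of_nonneg_left h1 hβ0.le
    simp only [hg_def]
    linarith
  set u := u₀ μ σ ρ with hu_def
  set z := upper μ σ ρ V₀ p h β Δ with hz_def
  have hz : z = sSup {z : ℝ | ∀ x : ℝ, 0 ≤ x → g x ≤ E * V₀ (x - z + u)} := by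
    rw [hz_def, upper, if_neg (not_le.2 hβ)]
    congr 1
    ext w
    refine forall₂_congr fun x hx => ?_
    rw [hgp x hx]
  obtain ⟨hzu, hgap, x₀, hx₀, htouch⟩ := exists_touching hVd hV1 hV00
    (by rw [hVu]; positivity) (by linarith) hg2.continuous hg0 (fun x _ => hgle x)
    ((hsd.const_mul β).add hmd) hslope hz
  set L := {x : ℝ | 0 < x ∧ g x = E * V₀ (x - z + u)} with hL_def
  have hu₁L : u₁ = sInf L := by
    rw [hu₁, lower]
    congr 1
    ext x
    refine and_congr_right fun hx => ?_
    rw [hgp x hx.le]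
  have hgap0 : g 0 < E * V₀ (0 - z + u) := by
    rw [hg0]
    exact mul_pos (by linarith) (hVpos (by linarith))
  -- Contact fails at 0, so the contact set is unchanged by admitting 0; it is closed and its
  -- infimum is attained.
  have hL_eq : L = Ici 0 ∩ {x | g x = E * V₀ (x - z + u)} := by
    ext x
    refine and_congr_left fun hx => ⟨fun h => h.le, fun h => lt_of_le_of_ne h ?_⟩
    rintro rfl
    exact hgap0.ne hx
  have hL_closed : IsClosed L := by
    rw [hL_eq]
    have := hVd.continuous
    exact isClosed_Ici.inter (isClosed_eq hg2.continuous (by fun_prop))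
  have hu₁mem : u₁ ∈ L := by
    rw [hu₁L]
    exact hL_closed.csInf_mem ⟨x₀, hL_eq ▸ ⟨hx₀, htouch⟩⟩ ⟨0, fun x hx => hx.1.le⟩
  obtain ⟨hu₁pos, hu₁eq⟩ := hu₁mem
  -- At x ≥ z the translate is at least E(μ/ρ + x - z) > (1 + ρΔ)(μ/ρ + x - z) ≥ μ/ρ + x - z + μΔ,
  -- whereas g(x) ≤ β + x + μΔ and β + z ≤ μ/ρ because K ≥ 0.
  have hu₁z : u₁ < z := by
    by_contra hcon
    rw [not_lt] at hcon
    have h1 := sub_le_sub_of_one_le_deriv hVd hV1 (by linarith : u ≤ u₁ - z + u)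
    have h2 := hgle u₁
    have h3 : μ / ρ * (ρ * Δ) = μ * Δ := by field_simp
    have h4 : 0 < μ / ρ := by positivity
    rw [hVu] at h1
    have h5 : (1 + ρ * Δ) * (μ / ρ + (u₁ - z)) ≤ E * (μ / ρ + (u₁ - z)) :=
      mul_le_mul_of_nonneg_right hE1.le (by linarith)
    have h6 : E * (μ / ρ + (u₁ - z)) ≤ E * V₀ (u₁ - z + u) :=
      mul_le_mul_of_nonneg_left (by linarith) (by linarith)
    have h7 : (1 + ρ * Δ) * (μ / ρ + (u₁ - z)) < E * (μ / ρ + (u₁ - z)) :=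
      mul_lt_mul_of_pos_right hE1 (by linarith)
    have h8 : (1 + ρ * Δ) * (μ / ρ + (u₁ - z))
        = μ / ρ + (u₁ - z) + μ * Δ + ρ * Δ * (u₁ - z) := by linear_combination h3
    have h9 := mul_nonneg hρΔ.le (sub_nonneg.2 hcon)
    linarith
  set gap : ℝ → ℝ := fun x => E * V₀ (x + (u - z)) - g x with hgap_def
  have hshift (x : ℝ) : x - z + u = x + (u - z) := by ring
  have hgap_min : IsLocalMin gap u₁ := by
    filter_upwards [Ioi_mem_nhds hu₁pos] with x hx
    have h1 := hgap x (le_of_lt hx)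
    rw [hshift] at h1 hu₁eq
    simp only [hgap_def]
    linarith
  have hgap_deriv := hgap_min.deriv_eq_zero
  have hgap_zero : gap u₁ = 0 := by
    rw [hshift] at hu₁eq
    simp only [hgap_def]
    linarith
  have hgap_pos : 0 < deriv (deriv gap) u₁ := by
    have key := deriv_deriv_gap_pos (a := a) (b := b) (A := A) (β := β) (d := u - z) (u := z)
      (x := u₁) hτ0 (by rw [← hVs]; exact hVpos (by linarith)) ?_ (by linarith) ?_ hu₁pos
    · rw [hexp, ← hVs] at key
      exact key hgap_zero hgap_deriv
    · rw [← hVs]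
      intro y y' hy
      have := sub_le_sub_of_one_le_deriv hVd hV1 (by linarith : y + (u - z) ≤ y' + (u - z))
      simp only
      linarith
    -- At y = z the data equal V₀(u₀) - β - z = K ≥ 0.
    · rw [← hVs, add_sub_cancel, hVu]
      linarith
  set G : ℝ → ℝ := fun x => E⁻¹ * g x with hG_def
  set mid : ℝ → ℝ := fun x => V₀ (x + (u - z)) with hmid_def
  set lin : ℝ → ℝ := fun x => x - z + μ / ρ with hlin_def
  have hG2 : ContDiff ℝ 2 G := contDiff_const.mul hg2
  have hmid2 : ContDiff ℝ 2 mid := hV₀.contDiff.comp (by fun_prop)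
  have hlin2 : ContDiff ℝ 2 lin := by fun_prop
  have hE0 : E ≠ 0 := by positivity
  have hgap_eq : gap = fun x => E * (mid x - G x) := by
    ext x
    simp only [hgap_def, hG_def, hmid_def]
    field_simp
  have hGd (x) := (hG2.differentiable (by simp) x).hasDerivAt
  have hmidd (x) := (hmid2.differentiable (by simp) x).hasDerivAt
  have hgap_d : deriv gap = fun x => E * (deriv mid x - deriv G x) := by
    rw [hgap_eq]
    exact funext fun x => (((hmidd x).sub (hGd x)).const_mul E).deriv
  have hGdd := differentiableAt_deriv_of_contDiffAt (hG2.contDiffAt (x := u₁))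
  have hmiddd := differentiableAt_deriv_of_contDiffAt (hmid2.contDiffAt (x := u₁))
  have hgap_dd : deriv (deriv gap) u₁ = E * (deriv (deriv mid) u₁ - deriv (deriv G) u₁) := by
    rw [hgap_d]
    exact ((hmiddd.hasDerivAt.sub hGdd.hasDerivAt).const_mul E).deriv
  have hmid_z' : deriv mid z = deriv lin z := by
    have h1 : deriv mid z = 1 := by
      simp only [hmid_def]
      rw [deriv_comp_add_const, add_sub_cancel]
      exact hV₀.slope
    have h2 : deriv lin z = 1 :=
      (((hasDerivAt_id z).sub_const z).add_const (μ / ρ)).deriv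
    rw [h1, h2]
  have hmid_z : mid z = lin z := by
    simp only [hmid_def, hlin_def, add_sub_cancel, hVu]
    ring
  have hG_u₁ : G u₁ = mid u₁ := by
    rw [hgap_eq] at hgap_zero
    have := (mul_eq_zero.1 hgap_zero).resolve_left hE0
    linarith
  have hG_u₁' : deriv G u₁ = deriv mid u₁ := by
    rw [hgap_d] at hgap_deriv
    have := (mul_eq_zero.1 hgap_deriv).resolve_left hE0
    linarith
  have hne : deriv (deriv G) u₁ ≠ deriv (deriv mid) u₁ := by
    intro heq
    rw [hgap_dd, heq, sub_self, mul_zero] at hgap_pos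
    exact lt_irrefl _ hgap_pos
  obtain ⟨hglued1, hglued2⟩ := contDiff_glued hG2 hmid2 hlin2 hu₁z hmid_z hmid_z' hG_u₁ hG_u₁' hne
  have hV_eq (x : ℝ) (hx : 0 ≤ x) :
      V x = if x ≤ u₁ then G x else if x ≤ z then mid x else lin x := by
    rw [hV, value, ← hu₁, ← hz_def, hgp x hx, Real.exp_neg]
    simp only [hG_def, hmid_def, hlin_def, add_sub_assoc]
    rfl
  refine ⟨hu₁pos, hglued1.contDiffOn.congr hV_eq, fun hcon => hglued2
    (hcon.congr_of_eventuallyEq ?_)⟩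
  filter_upwards [Ioi_mem_nhds hu₁pos] with x hx
  exact (hV_eq x (le_of_lt hx)).symm
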